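/- Let $K$ be a field of characteristic zero and let $G=(V,E)$ be a finite undirected graph, in which loops and multiple edges are allowed. Let $\gamma:E\to K\setminus\{0\}$ be a gain function. For an orientation $\sigma$ of $G$ let $A_g(G,\sigma,\gamma)=(a_{v,e})$ be the $V\times E$ matrix over $K$ with $$a_{v,e}=\begin{cases}\gamma(e)-1 & \text{if } e \text{ is a loop at } v,\\ -1 & \text{if } e \text{ is not a loop and begins at } v,\\ \gamma(e) & \text{if } e \text{ is not a loop and ends at } v,\\ 0 & \text{if } e \text{ is not incident to } v.\end{cases}$$ The circulation algebra $\mathcal C(G,\sigma,\gamma)$ is the $K$-subalgebra of $K[x_e : e\in E]/(x_e^2 : e\in E)$ generated by the elements $y_v=\sum_{e\in E}a_{v,e}x_e$, $v\in V$. It is graded by $\deg x_e=1$, and its Hilbert series is $\sum_{k\ge 0}\dim_K \mathcal C^k(G,\sigma,\gamma)\,t^k$, where $\mathcal C^k$ is the component of degree $k$. Cycles of $G$ are identified with their edge sets; a loop is a cycle of length $1$ and two parallel edges form a cycle of length $2$. **Theorem.** Suppose that for every cycle $S\subseteq E$ of $G$ and every subset $P\subseteq S$ $$\prod_{e\in P}\gamma(e)\ne\prod_{e\in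 S\setminus P}\gamma(e).$$ Then the Hilbert series of $\mathcal C(G,\sigma,\gamma)$ is the same for all orientations $\sigma$ of $G$ (with $\gamma$ fixed). Moreover, for every orientation $\sigma$, the dimension $\dim_K\mathcal C(G,\sigma,\gamma)$ is equal to the number of spanning pseudoforests of $G$, that is, of sets $F\subseteq E$ such that every connected component of $(V,F)$ contains at most one cycle. Equivalently, it is equal to the number of independent sets of the bicircular matroid of $G$, the matroid on $E$ whose independent sets are the edge sets of the spanning pseudoforests of $G$; in particular, these edge sets are the independent sets of a matroid. -/

import Mathlib

open scoped Graph

namespace Graph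

variable {α β : Type*}

/-- `S` is the edge set of a cycle of the multigraph `G`: there are distinct vertices
`v 0, …, v n` and distinct edges `e 0, …, e n` such that `e i` joins `v i` to `v (i + 1)`, where
indices are cyclic modulo `n + 1`. A loop is a cycle of length one and a pair of parallel edges is
a cycle of length two. -/
def IsCycle (G : Graph α β) (S : Set β) : Prop :=
  ∃ (n : ℕ) (v : Fin (n + 1) → α) (e : Fin (n + 1) → β),
    Function.Injective v ∧ Function.Injective e ∧
      (∀ i, G.IsLink (e i) (v i) (v (i + 1))) ∧ S = Set.range e

/-- The connected component of `G` containing the vertex `x`: the subgraph induced on the set of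
all vertices that can be reached from `x` by a walk in `G`. -/
def component (G : Graph α β) (x : α) : Graph α β :=
  G.induce {y | Relation.ReflTransGen G.Adj x y}

/-- `G` is a pseudoforest: every connected component of `G` contains at most one cycle, that is,
it is either a tree or a unicycle. -/
def IsPseudoforest (G : Graph α β) : Prop :=
  ∀ x ∈ V(G), ∀ S T : Set β,
    (G.component x).IsCycle S → (G.component x).IsCycle T → S = T

/-- The spanning pseudoforests of `G`, as edge sets: the sets `F` of edges of `G` such that the
spanning subgraph `(V(G), F)` is a pseudoforest. -/
def spanningPseudoforests (G : Graph α β) : Set (Set β) :=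
  {F | F ⊆ E(G) ∧ (G.restrict F).IsPseudoforest}

/-- `M` is the bicircular matroid of `G`: the matroid on the edge set of `G` whose independent sets
are the edge sets of the spanning pseudoforests of `G`. -/
def IsBicircularMatroid (G : Graph α β) (M : Matroid β) : Prop :=
  M.E = E(G) ∧ ∀ I : Set β, M.Indep I ↔ I ∈ G.spanningPseudoforests

/-- An orientation of `G`: every edge is given an initial vertex `tail` and a final vertex `head`
which together are its ends. -/
structure Orientation (G : Graph α β) where
  tail : E(G) → V(G)
  head : E(G) → V(G)
  isLink : ∀ e : E(G), G.IsLink (e : β) (tail e : α) (head e : α)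

open Classical in
/-- The incidence matrix of the gain graph `(G, σ, γ)`: the entry at `(v, e)` is `-1` if the edge
`e` begins at `v`, `γ e` if it ends at `v`, `γ e - 1` if `e` is a loop at `v`, and `0` if `e` is not
incident to `v`. -/
noncomputable def gainMatrix {K : Type*} [Field K] (G : Graph α β) (σ : G.Orientation)
    (γ : β → K) : Matrix V(G) E(G) K := fun v e =>
  if σ.tail e = v then
    if σ.head e = v then γ e - 1 else -1
  else
    if σ.head e = v then γ e else 0

open Classical in
/-- The gains `γ` are generic: for every cycle `S` of `G` and every subset `P` of `S` the product
of the gains over `P` differs from the product of the gains over `S \ P`. -/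
def GenericGains {K : Type*} [Field K] (G : Graph α β) (γ : β → K) : Prop :=
  ∀ S : Finset β, G.IsCycle (S : Set β) → ∀ P : Finset β, P ⊆ S →
    ∏ e ∈ P, γ e ≠ ∏ e ∈ S \ P, γ e

end Graph

/-- The ideal generated by the squares of the variables `x_e`. -/
noncomputable def squareIdeal (K : Type*) [Field K] (E : Type*) : Ideal (MvPolynomial E K) :=
  Ideal.span (Set.range fun e : E => (MvPolynomial.X e : MvPolynomial E K) ^ 2)

/-- The square-free algebra `K[x_e : e ∈ E] / (x_e ^ 2 : e ∈ E)`. -/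
noncomputable abbrev SquareFreeAlgebra (K : Type*) [Field K] (E : Type*) : Type _ :=
  MvPolynomial E K ⧸ squareIdeal K E

namespace SquareFreeAlgebra

/-- The class of the variable `x_e`. -/
noncomputable def x (K : Type*) [Field K] {E : Type*} (e : E) : SquareFreeAlgebra K E :=
  Ideal.Quotient.mkₐ K (squareIdeal K E) (MvPolynomial.X e)

/-- The component of degree `k` of the square-free algebra, graded by the degree of
polynomials. -/
noncomputable def degreePart (K : Type*) [Field K] (E : Type*) (k : ℕ) :
    Submodule K (SquareFreeAlgebra K E) :=
  (MvPolynomial.homogeneousSubmodule E K k).map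
    (Ideal.Quotient.mkₐ K (squareIdeal K E)).toLinearMap

end SquareFreeAlgebra

/-- The circulation algebra of a matrix `A`: the subalgebra of the square-free algebra generated
by the elements `y_v = ∑ e, A v e * x_e`, one for each row `v` of `A`. -/
noncomputable def circulationAlgebra {K : Type*} [Field K] {V E : Type*} [Fintype E]
    (A : Matrix V E K) : Subalgebra K (SquareFreeAlgebra K E) :=
  Algebra.adjoin K (Set.range fun v : V => ∑ e : E, A v e • SquareFreeAlgebra.x K e)

/-- The graded component of degree `k` of the circulation algebra of `A`: its elements that are
homogeneous of degree `k` in the square-free algebra. -/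
noncomputable def circulationDegreePart {K : Type*} [Field K] {V E : Type*} [Fintype E]
    (A : Matrix V E K) (k : ℕ) : Submodule K (SquareFreeAlgebra K E) :=
  Subalgebra.toSubmodule (circulationAlgebra A) ⊓ SquareFreeAlgebra.degreePart K E k

/-- The Hilbert series of the circulation algebra of `A`: the power series whose `k`-th coefficient
is the dimension of the graded component of degree `k`. -/
noncomputable def circulationHilbertSeries {K : Type*} [Field K] {V E : Type*} [Fintype E]
    (A : Matrix V E K) : PowerSeries ℤ :=
  PowerSeries.mk fun k => (Module.finrank K (circulationDegreePart A k) : ℤ)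

/-! The coefficient of the square-free monomial `x_S` in `y^m` is `m!` times the coefficient of
`X^m` in the product, over `e ∈ S`, of the linear forms `ℓ_e` given by the columns of the matrix. In
characteristic zero the factorials are invertible, so the algebra and the span of these products
have equal dimensions, in total and in each degree (`finrank_map_coeffMap`).

The span of the products over all subsets of a family of vectors obeys deletion and contraction:
multiplication by a nonzero `ℓ_e` embeds the span for the family without `e`, and setting `ℓ_e = 0`
maps onto the span for the contracted family. The hard point is exactness in the middle. It follows
once the span is described as the polynomials whose degree in each direction `h` is at most the
number of vectors not orthogonal to `h` (`degreeBounded_le_prodSpan`). Hence the total dimension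
counts independent sets, and the graded dimensions depend only on the linear matroid of the columns.

It remains to identify this matroid (`linearIndepOn_gainColumn_iff`). A linear functional `p` on the
vertex space kills the column of `e` when `p(tail) = γ(e) p(head)`; call it a potential. Going round
a cycle multiplies a potential by a product of factors `γ(e)` and `γ(e)⁻¹`, the orientation deciding
which. Genericity, being imposed for all `P`, keeps this product away from `1` under every
orientation. So potentials vanish on cycles, whereas an acyclic component carries a nowhere zero
one, and the independent sets are the spanning pseudoforests for every `σ`. -/

set_option linter.unusedSectionVars false

/-! ### Spans of products of linear forms, and their description by degrees along lines. -/

section ZonotopalSpace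

open MvPolynomial

variable {K : Type*} [Field K] {V E : Type*} [Fintype V]

/-- The linear form with coefficient vector `c`. -/
noncomputable def linForm : (V → K) →ₗ[K] MvPolynomial V K where
  toFun c := ∑ i, c i • X i
  map_add' c d := by simp [add_smul, Finset.sum_add_distrib]
  map_smul' r c := by simp [Finset.smul_sum, smul_smul]

lemma smul_X_isHomogeneous (r : K) (i : V) : (r • (X i : MvPolynomial V K)).IsHomogeneous 1 := by
  rw [smul_eq_C_mul]; exact isHomogeneous_C_mul_X r i

lemma linForm_isHomogeneous (c : V → K) : (linForm c).IsHomogeneous 1 :=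
  IsHomogeneous.sum _ _ _ fun i _ => smul_X_isHomogeneous _ i

lemma linForm_single [DecidableEq V] (i : V) (r : K) :
    linForm (Pi.single i r) = r • (X i : MvPolynomial V K) := by
  simp [linForm, Pi.single_apply, ite_smul]

lemma coeff_linForm (c : V → K) (i : V) : coeff (Finsupp.single i 1) (linForm c) = c i := by
  classical
  simp [linForm, coeff_sum, coeff_X, Finsupp.single_left_inj]

lemma linForm_ne_zero {c : V → K} (hc : c ≠ 0) : linForm c ≠ 0 := by
  intro h
  apply hc
  funext i
  rw [← coeff_linForm c i, h]; simp

lemma aeval_linForm {A : Type*} [CommRing A] [Algebra K A] (g : V → A) (c : V → K) :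
    aeval g (linForm c) = ∑ i, c i • g i := by
  simp [linForm]

/-- The product of the linear forms indexed by `S`. -/
noncomputable def formProd (a : E → V → K) (S : Finset E) : MvPolynomial V K :=
  ∏ e ∈ S, linForm (a e)

lemma formProd_insert [DecidableEq E] (a : E → V → K) {S : Finset E} {e : E} (he : e ∉ S) :
    formProd a (insert e S) = linForm (a e) * formProd a S := Finset.prod_insert he

lemma formProd_isHomogeneous (a : E → V → K) (S : Finset E) :
    (formProd a S).IsHomogeneous S.card := by
  have := IsHomogeneous.prod S (fun e => linForm (a e)) (fun _ => 1)
    fun e _ => linForm_isHomogeneous (a e)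
  simpa [formProd] using this

/-- The span of the products of linear forms indexed by the members of `𝒮`. -/
noncomputable def prodSpan (𝒮 : Finset (Finset E)) (a : E → V → K) :
    Submodule K (MvPolynomial V K) :=
  Submodule.span K (formProd a '' 𝒮)

instance (𝒮 : Finset (Finset E)) (a : E → V → K) : FiniteDimensional K (prodSpan 𝒮 a) :=
  FiniteDimensional.span_of_finite K (𝒮.finite_toSet.image _)

lemma prodSpan_mono {𝒮 𝒯 : Finset (Finset E)} (h : 𝒮 ⊆ 𝒯) (a : E → V → K) :
    prodSpan 𝒮 a ≤ prodSpan 𝒯 a :=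
  Submodule.span_mono (Set.image_mono (by exact_mod_cast h))

lemma formProd_mem {𝒮 : Finset (Finset E)} {S : Finset E} (h : S ∈ 𝒮) (a : E → V → K) :
    formProd a S ∈ prodSpan 𝒮 a :=
  Submodule.subset_span ⟨S, h, rfl⟩

lemma formProd_eq_zero {a : E → V → K} {S : Finset E} {e : E} (he : e ∈ S) (h : a e = 0) :
    formProd a S = 0 :=
  Finset.prod_eq_zero he (by rw [h, map_zero])

/-- Only those sets matter which avoid a given zero vector. -/
lemma prodSpan_eq_of_zero {𝒮 𝒯 : Finset (Finset E)} {a : E → V → K} {e : E} (h : a e = 0)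
    (h𝒮 : 𝒮 ⊆ 𝒯) (h𝒯 : ∀ S ∈ 𝒯, S ∉ 𝒮 → e ∈ S) : prodSpan 𝒯 a = prodSpan 𝒮 a := by
  apply le_antisymm _ (prodSpan_mono h𝒮 a)
  rw [prodSpan, Submodule.span_le]
  rintro _ ⟨S, hS, rfl⟩
  by_cases hS' : S ∈ 𝒮
  · exact formProd_mem hS' a
  · rw [formProd_eq_zero (h𝒯 S hS hS') h]; exact zero_mem _

lemma prodSpan_powerset_of_zero [DecidableEq E] {a : E → V → K} {e : E} (h : a e = 0)
    (s : Finset E) : prodSpan (insert e s).powerset a = prodSpan s.powerset a := by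
  apply prodSpan_eq_of_zero h (Finset.powerset_mono.2 (Finset.subset_insert e s))
  intro S hS hS'
  rw [Finset.mem_powerset] at hS hS'
  by_contra he
  exact hS' ((Finset.subset_insert_iff_of_notMem he).1 hS)

lemma prodSpan_powersetCard_of_zero [DecidableEq E] {a : E → V → K} {e : E} (h : a e = 0)
    (s : Finset E) (k : ℕ) :
    prodSpan (Finset.powersetCard k (insert e s)) a = prodSpan (Finset.powersetCard k s) a := by
  apply prodSpan_eq_of_zero h (Finset.powersetCard_mono (Finset.subset_insert e s))
  intro S hS hS'
  rw [Finset.mem_powersetCard] at hS hS'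
  by_contra he
  exact hS' ⟨(Finset.subset_insert_iff_of_notMem he).1 hS.1, hS.2⟩

/-- The substitution `X_i ↦ X_i + h_i T`. -/
noncomputable def shiftHom (h : V → K) : MvPolynomial V K →ₐ[K] Polynomial (MvPolynomial V K) :=
  aeval fun i => Polynomial.C (X i) + Polynomial.C (C (h i)) * Polynomial.X

lemma shiftHom_linForm (h c : V → K) :
    shiftHom h (linForm c) =
      Polynomial.C (linForm c) + Polynomial.C (C (c ⬝ᵥ h)) * Polynomial.X := by
  rw [shiftHom, aeval_linForm]
  simp only [smul_add, Finset.sum_add_distrib, linForm, LinearMap.coe_mk, AddHom.coe_mk, map_sum,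
    dotProduct, Finset.sum_mul]
  congr 1
  · refine Finset.sum_congr rfl fun i _ => ?_
    rw [Polynomial.smul_C]
  · refine Finset.sum_congr rfl fun i _ => ?_
    rw [← smul_mul_assoc, Polynomial.smul_C, C_mul, smul_eq_C_mul]

lemma shiftHom_linForm_ne_zero (h : V → K) {c : V → K} (hc : c ≠ 0) :
    shiftHom h (linForm c) ≠ 0 := by
  intro h0
  have := congrArg (fun p => Polynomial.coeff p 0) h0
  rw [shiftHom_linForm] at this
  simp at this
  exact linForm_ne_zero hc this

open Classical in
lemma natDegree_shiftHom_linForm (h c : V → K) :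
    (shiftHom h (linForm c)).natDegree = if c ⬝ᵥ h ≠ 0 then 1 else 0 := by
  rw [shiftHom_linForm, add_comm]
  split_ifs with H
  · exact Polynomial.natDegree_linear (by simpa using H)
  · rw [not_not] at H
    simp [H]

open Classical in
/-- The polynomials whose degree along each line is bounded by the number of the linear forms
which are not constant on it. -/
noncomputable def degreeBounded (s : Finset E) (a : E → V → K) :
    Submodule K (MvPolynomial V K) where
  carrier := {f | ∀ h, (shiftHom h f).natDegree ≤ (s.filter fun e => a e ⬝ᵥ h ≠ 0).card}
  zero_mem' h := by simp
  add_mem' {f g} hf hg h := by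
    rw [map_add]
    exact (Polynomial.natDegree_add_le _ _).trans (max_le (hf h) (hg h))
  smul_mem' r f hf h := by
    rw [map_smul]
    exact (Polynomial.natDegree_smul_le _ _).trans (hf h)

lemma prodSpan_le_degreeBounded (s : Finset E) (a : E → V → K) :
    prodSpan s.powerset a ≤ degreeBounded s a := by
  classical
  rw [prodSpan, Submodule.span_le]
  rintro _ ⟨S, hS, rfl⟩ h
  rw [formProd, map_prod]
  refine (Polynomial.natDegree_prod_le _ _).trans ?_
  simp only [natDegree_shiftHom_linForm, ← Finset.card_filter]
  exact Finset.card_le_card (Finset.filter_subset_filter _ (by simpa using hS))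

lemma eval_shiftHom (h : V → K) (f : MvPolynomial V K) :
    eval 0 ((shiftHom h f).eval 1) = eval h f := by
  have : ((aeval (0 : V → K)).comp
      (((Polynomial.aeval (1 : MvPolynomial V K)).restrictScalars K).comp (shiftHom h))) =
      aeval h := by
    ext i
    simp [shiftHom]
  have := DFunLike.congr_fun this f
  simpa [Polynomial.aeval_def, Polynomial.eval₂_eq_eval_map, aeval_eq_eval] using this

lemma eval_zero_shiftHom (h : V → K) (f : MvPolynomial V K) : (shiftHom h f).eval 0 = f := by
  have : (((Polynomial.aeval (0 : MvPolynomial V K)).restrictScalars K).comp (shiftHom h)) =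
      AlgHom.id K _ := by
    ext i
    simp [shiftHom]
  have := DFunLike.congr_fun this f
  simpa [Polynomial.aeval_def, Polynomial.eval₂_eq_eval_map] using this

/-- On the line through the origin in direction `h` the polynomial is constant, so `f(h) = f(0)`;
over an infinite field the values determine `f`. This is the base case of
`degreeBounded_le_prodSpan`. -/
lemma eq_C_of_natDegree_shiftHom [Infinite K] {f : MvPolynomial V K}
    (hf : ∀ h, (shiftHom h f).natDegree = 0) : f = C (eval 0 f) := by
  apply MvPolynomial.funext
  intro h
  rw [eval_C, ← eval_shiftHom h f]
  obtain ⟨g, hg⟩ := Polynomial.natDegree_eq_zero.1 (hf h)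
  have := eval_zero_shiftHom h f
  rw [← hg] at this ⊢
  simp at this ⊢
  rw [this]

/-- The projection of the space of vectors along `c` to the vectors vanishing at `i₀`. -/
noncomputable def projAlong (c : V → K) (i₀ : V) : (V → K) →ₗ[K] (V → K) :=
  LinearMap.id - (LinearMap.proj i₀).smulRight ((c i₀)⁻¹ • c)

lemma projAlong_apply (c : V → K) (i₀ : V) (d : V → K) :
    projAlong c i₀ d = d - (d i₀ * (c i₀)⁻¹) • c := by
  simp [projAlong, smul_smul]

lemma projAlong_self {c : V → K} {i₀ : V} (h : c i₀ ≠ 0) : projAlong c i₀ c = 0 := by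
  simp [projAlong_apply, h]

lemma ker_projAlong {c : V → K} {i₀ : V} (h : c i₀ ≠ 0) :
    LinearMap.ker (projAlong c i₀) = Submodule.span K {c} := by
  ext d
  rw [LinearMap.mem_ker, Submodule.mem_span_singleton]
  constructor
  · intro hd
    exact ⟨_, (sub_eq_zero.1 ((projAlong_apply c i₀ d).symm.trans hd)).symm⟩
  · rintro ⟨r, rfl⟩
    rw [map_smul, projAlong_self h, smul_zero]

/-- The endomorphism of the polynomial ring which acts on linear forms by `projAlong`. -/
noncomputable def projHom (c : V → K) (i₀ : V) : MvPolynomial V K →ₐ[K] MvPolynomial V K :=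
  open Classical in aeval fun i => linForm (projAlong c i₀ (Pi.single i 1))

lemma projHom_linForm (c : V → K) (i₀ : V) (d : V → K) :
    projHom c i₀ (linForm d) = linForm (projAlong c i₀ d) := by
  classical
  rw [projHom, aeval_linForm]
  conv_rhs => rw [pi_eq_sum_univ' d]
  simp only [map_sum, map_smul]

lemma projHom_formProd (c : V → K) (i₀ : V) (a : E → V → K) (S : Finset E) :
    projHom c i₀ (formProd a S) = formProd (fun e => projAlong c i₀ (a e)) S := by
  simp [formProd, map_prod, projHom_linForm]

lemma map_projHom_prodSpan (c : V → K) (i₀ : V) (a : E → V → K) (𝒮 : Finset (Finset E)) :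
    (prodSpan 𝒮 a).map (projHom c i₀).toLinearMap =
      prodSpan 𝒮 (fun e => projAlong c i₀ (a e)) := by
  rw [prodSpan, Submodule.map_span, ← Set.image_comp, prodSpan]
  congr 1
  exact Set.image_congr fun S _ => projHom_formProd c i₀ a S

/-- Modulo `linForm c` the projection fixes every variable, since it changes linear forms by
multiples of `linForm c`. In particular, whatever the projection kills is divisible by `linForm c`.
-/
lemma linForm_dvd_sub_projHom (c : V → K) (i₀ : V) (f : MvPolynomial V K) :
    linForm c ∣ f - projHom c i₀ f := by
  classical
  rw [← Ideal.mem_span_singleton, ← Ideal.Quotient.mk_eq_mk_iff_sub_mem]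
  have : (Ideal.Quotient.mkₐ K (Ideal.span {linForm c})) =
      (Ideal.Quotient.mkₐ K (Ideal.span {linForm c})).comp (projHom c i₀) := by
    ext i
    simp only [AlgHom.comp_apply, Ideal.Quotient.mkₐ_eq_mk]
    rw [Ideal.Quotient.mk_eq_mk_iff_sub_mem, Ideal.mem_span_singleton]
    have h1 : (X i : MvPolynomial V K) = linForm (Pi.single i 1) := by
      rw [linForm_single, one_smul]
    rw [h1, projHom_linForm, ← map_sub, projAlong_apply, sub_sub_cancel, map_smul, smul_eq_C_mul]
    exact Dvd.intro_left _ rfl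
  exact DFunLike.congr_fun this f

lemma shiftHom_projHom (c : V → K) (i₀ : V) (h h' : V → K)
    (hh : ∀ d, d ⬝ᵥ h' = projAlong c i₀ d ⬝ᵥ h) (f : MvPolynomial V K) :
    shiftHom h (projHom c i₀ f) = (shiftHom h' f).map (projHom c i₀ : _ →+* _) := by
  classical
  have : (shiftHom h).comp (projHom c i₀) =
      (Polynomial.mapAlgHom (projHom c i₀)).comp (shiftHom h') := by
    ext1 i
    have h1 : (X i : MvPolynomial V K) = linForm (Pi.single i 1) := by
      rw [linForm_single, one_smul]
    rw [AlgHom.comp_apply, AlgHom.comp_apply, h1, projHom_linForm, shiftHom_linForm,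
      shiftHom_linForm, ← hh]
    simp [projHom_linForm]
  exact DFunLike.congr_fun this f

lemma exists_dotProduct_eq_projAlong (c : V → K) (i₀ : V) (h : V → K) :
    ∃ h' : V → K, ∀ d, d ⬝ᵥ h' = projAlong c i₀ d ⬝ᵥ h := by
  classical
  -- This vector is the transpose of the projection applied to `h`.
  refine ⟨h - Pi.single i₀ ((c i₀)⁻¹ * (c ⬝ᵥ h)), fun d => ?_⟩
  rw [projAlong_apply, dotProduct_sub, sub_dotProduct, dotProduct_single, smul_dotProduct,
    smul_eq_mul]
  ring

/-- A direction `h` for the contracted vectors corresponds to a direction `h'` orthogonal to `a e`,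
so `e` drops out of the bound. -/
lemma projHom_mem_degreeBounded [DecidableEq E] {s : Finset E} {a : E → V → K} {e : E} {i₀ : V}
    (hi : a e i₀ ≠ 0) {f : MvPolynomial V K} (hf : f ∈ degreeBounded (insert e s) a) :
    projHom (a e) i₀ f ∈ degreeBounded s fun e' => projAlong (a e) i₀ (a e') := by
  classical
  intro h
  obtain ⟨h', hh⟩ := exists_dotProduct_eq_projAlong (a e) i₀ h
  rw [shiftHom_projHom _ _ h h' hh]
  refine Polynomial.natDegree_map_le.trans ((hf h').trans ?_)
  simp only [hh]
  rw [Finset.filter_insert, projAlong_self hi]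
  simp

/-- Degrees add over a domain, and `linForm (a e)` has degree one in exactly those directions in
which `e` contributes one to the bound. -/
lemma mem_degreeBounded_of_mul [DecidableEq E] {s : Finset E} {a : E → V → K} {e : E}
    (he : e ∉ s) (hae : a e ≠ 0) {g : MvPolynomial V K}
    (h : linForm (a e) * g ∈ degreeBounded (insert e s) a) : g ∈ degreeBounded s a := by
  classical
  intro v
  by_cases hg : shiftHom v g = 0
  · simp [hg]
  have := h v
  rw [map_mul, Polynomial.natDegree_mul (shiftHom_linForm_ne_zero v hae) hg,
    natDegree_shiftHom_linForm, Finset.filter_insert] at this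
  split_ifs at this with H
  · rw [Finset.card_insert_of_notMem (by simp [he])] at this
    omega
  · simpa using this

lemma linForm_mul_mem [DecidableEq E] {s : Finset E} {a : E → V → K} {e : E} (he : e ∉ s)
    {𝒮 𝒯 : Finset (Finset E)} (h𝒮 : ∀ S ∈ 𝒮, S ⊆ s) (h𝒯 : ∀ S ∈ 𝒮, insert e S ∈ 𝒯)
    {g : MvPolynomial V K} (hg : g ∈ prodSpan 𝒮 a) : linForm (a e) * g ∈ prodSpan 𝒯 a := by
  induction hg using Submodule.span_induction with
  | mem _ h =>
    obtain ⟨S, hS, rfl⟩ := h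
    rw [← formProd_insert a fun h => he (h𝒮 S hS h)]
    exact formProd_mem (h𝒯 S hS) a
  | zero => simp
  | add _ _ _ _ h1 h2 => rw [mul_add]; exact add_mem h1 h2
  | smul r _ _ h => rw [mul_smul_comm]; exact Submodule.smul_mem _ r h

lemma linForm_mul_mem_powerset [DecidableEq E] {s : Finset E} {a : E → V → K} {e : E}
    (he : e ∉ s) {g : MvPolynomial V K} (hg : g ∈ prodSpan s.powerset a) :
    linForm (a e) * g ∈ prodSpan (insert e s).powerset a :=
  linForm_mul_mem he (fun _ => Finset.mem_powerset.1)
    (fun _ hS => Finset.mem_powerset.2 (Finset.insert_subset_insert e (Finset.mem_powerset.1 hS)))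
    hg

/-- The span of the products of linear forms is described by its degrees along lines. -/
theorem degreeBounded_le_prodSpan [Infinite K] (s : Finset E) :
    ∀ a : E → V → K, degreeBounded s a ≤ prodSpan s.powerset a := by
  classical
  induction s using Finset.induction with
  | empty =>
    intro a f hf
    have h0 := eq_C_of_natDegree_shiftHom (f := f) fun h => by simpa using hf h
    rw [h0, ← mul_one (C _), ← smul_eq_C_mul]
    exact Submodule.smul_mem _ _ (formProd_mem (𝒮 := Finset.powerset ∅) (S := ∅) (by simp) a)
  | insert e s he ih =>
    intro a f hf
    by_cases hae : a e = 0
    · rw [prodSpan_powerset_of_zero hae]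
      refine ih a fun h => (hf h).trans_eq ?_
      rw [Finset.filter_insert, hae]; simp
    · obtain ⟨i₀, hi⟩ := Function.ne_iff.1 hae
      -- By induction the projection of `f` is the projection of some `p` in the span. Then `f - p`
      -- is killed by the projection, hence divisible by the form of `e`, and induction for the
      -- original vectors applies to the quotient.
      have hf' := ih _ (projHom_mem_degreeBounded hi hf)
      rw [← map_projHom_prodSpan] at hf'
      obtain ⟨p, hp, hpf⟩ := hf'
      have hp' : p ∈ prodSpan (insert e s).powerset a :=
        prodSpan_mono (Finset.powerset_mono.2 (Finset.subset_insert e s)) a hp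
      have hsub : f - p ∈ degreeBounded (insert e s) a :=
        sub_mem hf (prodSpan_le_degreeBounded _ a hp')
      obtain ⟨g, hg⟩ := linForm_dvd_sub_projHom (a e) i₀ (f - p)
      have hpf' : projHom (a e) i₀ p = projHom (a e) i₀ f := hpf
      rw [map_sub, hpf', sub_self, sub_zero] at hg
      have hgm := linForm_mul_mem_powerset he
        (ih a (mem_degreeBounded_of_mul he hae (hg ▸ hsub)))
      rw [← hg] at hgm
      simpa using add_mem hgm hp'

/-- Exactness in the middle of the deletion-contraction sequence. The quotient by the form of `e`
visibly satisfies the degree bounds for `s`, and these suffice for it to lie in the span. -/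
lemma exists_eq_mul_of_projHom_eq_zero [Infinite K] [DecidableEq E] {s : Finset E}
    {a : E → V → K} {e : E} (he : e ∉ s) {i₀ : V} (hi : a e i₀ ≠ 0) {f : MvPolynomial V K}
    (hf : f ∈ prodSpan (insert e s).powerset a) (h0 : projHom (a e) i₀ f = 0) :
    ∃ g ∈ prodSpan s.powerset a, f = linForm (a e) * g := by
  obtain ⟨g, hg⟩ := linForm_dvd_sub_projHom (a e) i₀ f
  rw [h0, sub_zero] at hg
  refine ⟨g, degreeBounded_le_prodSpan s a (mem_degreeBounded_of_mul he ?_ ?_), hg⟩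
  · exact Function.ne_iff.2 ⟨i₀, hi⟩
  · rw [← hg]; exact prodSpan_le_degreeBounded _ a hf

end ZonotopalSpace

/-! ### Deletion and contraction for dimensions; counting independent sets. -/

section ZonotopalDimension

open MvPolynomial

variable {K : Type*} [Field K] {V E : Type*} [Fintype V]

/-- Rank-nullity for the sequence `0 → U' → U → U'' → 0`, whose maps are multiplication by `φ` and
`r`. -/
lemma finrank_eq_add_of_mul {R : Type*} [CommRing R] [IsDomain R] [Algebra K R] {φ : R}
    (hφ : φ ≠ 0) (r : R →ₗ[K] R) (U U' U'' : Submodule K R) [FiniteDimensional K U]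
    (hmul : ∀ g ∈ U', φ * g ∈ U ∧ r (φ * g) = 0)
    (hker : ∀ f ∈ U, r f = 0 → ∃ g ∈ U', f = φ * g) (hmap : U.map r = U'') :
    Module.finrank K U = Module.finrank K U' + Module.finrank K U'' := by
  have h1 := (r.domRestrict U).finrank_range_add_finrank_ker
  have h2 : LinearMap.range (r.domRestrict U) = U'' := by
    rw [← hmap, LinearMap.range_domRestrict]
  have h3 : (LinearMap.ker (r.domRestrict U)).map U.subtype = U'.map (LinearMap.mulLeft K φ) := by
    ext f
    simp only [Submodule.mem_map, LinearMap.mem_ker, LinearMap.domRestrict_apply,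
      Submodule.coe_subtype, LinearMap.mulLeft_apply]
    constructor
    · rintro ⟨u, hu, rfl⟩
      obtain ⟨g, hg, h⟩ := hker u u.2 hu
      exact ⟨g, hg, h.symm⟩
    · rintro ⟨g, hg, rfl⟩
      exact ⟨⟨_, (hmul g hg).1⟩, (hmul g hg).2, rfl⟩
  have h4 := congrArg (fun W : Submodule K R => Module.finrank K W) h3
  rw [Submodule.finrank_map_subtype_eq,
    ← (Submodule.equivMapOfInjective _ (mul_right_injective₀ hφ) U').finrank_eq] at h4
  rw [h2] at h1
  omega

lemma finrank_prodSpan_insert [Infinite K] [DecidableEq E] {s : Finset E} {a : E → V → K} {e : E}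
    (he : e ∉ s) {i₀ : V} (hi : a e i₀ ≠ 0) :
    Module.finrank K (prodSpan (insert e s).powerset a) =
      Module.finrank K (prodSpan s.powerset a) +
      Module.finrank K (prodSpan s.powerset fun e' => projAlong (a e) i₀ (a e')) := by
  refine finrank_eq_add_of_mul (φ := linForm (a e)) (linForm_ne_zero (Function.ne_iff.2 ⟨i₀, hi⟩))
    (projHom (a e) i₀).toLinearMap _ _ _ (fun g hg => ⟨linForm_mul_mem_powerset he hg, ?_⟩)
    (fun f hf h0 => exists_eq_mul_of_projHom_eq_zero he hi hf h0) ?_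
  · simp [projHom_linForm, projAlong_self hi]
  · rw [map_projHom_prodSpan, prodSpan_powerset_of_zero (e := e) (projAlong_self hi)]

lemma isHomogeneous_of_mem_prodSpan {s : Finset E} {a : E → V → K} {k : ℕ}
    {f : MvPolynomial V K} (hf : f ∈ prodSpan (Finset.powersetCard k s) a) :
    f.IsHomogeneous k := by
  rw [← mem_homogeneousSubmodule]
  refine (Submodule.span_le.2 ?_ : prodSpan (Finset.powersetCard k s) a ≤ _) hf
  rintro _ ⟨S, hS, rfl⟩
  rw [← (Finset.mem_powersetCard.1 hS).2]
  exact formProd_isHomogeneous a S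

lemma powersetCard_subset_powerset (k : ℕ) (s : Finset E) :
    Finset.powersetCard k s ⊆ s.powerset := fun _ hS =>
  Finset.mem_powerset.2 (Finset.mem_powersetCard.1 hS).1

lemma homogeneousComponent_mem_prodSpan {s : Finset E} {a : E → V → K}
    {f : MvPolynomial V K} (hf : f ∈ prodSpan s.powerset a) (k : ℕ) :
    homogeneousComponent k f ∈ prodSpan (Finset.powersetCard k s) a := by
  induction hf using Submodule.span_induction with
  | mem _ h =>
    obtain ⟨S, hS, rfl⟩ := h
    rw [homogeneousComponent_of_mem (formProd_isHomogeneous a S)]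
    split_ifs with h
    · exact formProd_mem (Finset.mem_powersetCard.2 ⟨Finset.mem_powerset.1 hS, h.symm⟩) a
    · exact zero_mem _
  | zero => simp
  | add _ _ _ _ h1 h2 => rw [map_add]; exact add_mem h1 h2
  | smul r _ _ h => rw [map_smul]; exact Submodule.smul_mem _ r h

lemma homogeneousComponent_succ_mul {φ : MvPolynomial V K} (hφ : φ.IsHomogeneous 1) (k : ℕ)
    (g : MvPolynomial V K) :
    homogeneousComponent (k + 1) (φ * g) = φ * homogeneousComponent k g := by
  induction g using MvPolynomial.monomial_add_induction_on with
  | C r =>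
    have h1 : (φ * C r).IsHomogeneous 1 := by simpa using hφ.mul (isHomogeneous_C V r)
    rw [homogeneousComponent_of_mem h1, homogeneousComponent_of_mem (isHomogeneous_C V r)]
    simp
  | monomial_add m r f _ _ h =>
    have h2 : (monomial m r : MvPolynomial V K).IsHomogeneous m.degree :=
      isHomogeneous_monomial r rfl
    have h1 := hφ.mul h2
    rw [mul_add, map_add, map_add, h, mul_add, homogeneousComponent_of_mem h1,
      homogeneousComponent_of_mem h2, add_comm 1]
    simp

lemma finrank_prodSpan_powersetCard_insert [Infinite K] [DecidableEq E] {s : Finset E}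
    {a : E → V → K} {e : E} (he : e ∉ s) {i₀ : V} (hi : a e i₀ ≠ 0) (k : ℕ) :
    Module.finrank K (prodSpan (Finset.powersetCard (k + 1) (insert e s)) a) =
      Module.finrank K (prodSpan (Finset.powersetCard k s) a) +
      Module.finrank K
        (prodSpan (Finset.powersetCard (k + 1) s) fun e' => projAlong (a e) i₀ (a e')) := by
  refine finrank_eq_add_of_mul (φ := linForm (a e)) (linForm_ne_zero (Function.ne_iff.2 ⟨i₀, hi⟩))
    (projHom (a e) i₀).toLinearMap _ _ _ (fun g hg => ⟨?_, ?_⟩) (fun f hf h0 => ?_) ?_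
  · refine linForm_mul_mem he (fun S hS => (Finset.mem_powersetCard.1 hS).1) (fun S hS => ?_) hg
    rw [Finset.mem_powersetCard] at hS ⊢
    exact ⟨Finset.insert_subset_insert e hS.1,
      by rw [Finset.card_insert_of_notMem fun h => he (hS.1 h), hS.2]⟩
  · simp [projHom_linForm, projAlong_self hi]
  · obtain ⟨g, hg, rfl⟩ := exists_eq_mul_of_projHom_eq_zero he hi
      (prodSpan_mono (powersetCard_subset_powerset _ _) a hf) h0
    -- The factor `g` is only known to lie in the ungraded span; as the product is homogeneous of
    -- degree `k + 1`, its component of degree `k` serves as well.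
    refine ⟨homogeneousComponent k g, homogeneousComponent_mem_prodSpan hg k, ?_⟩
    rw [← homogeneousComponent_succ_mul (linForm_isHomogeneous _),
      homogeneousComponent_eq_self (isHomogeneous_of_mem_prodSpan hf)]
  · rw [map_projHom_prodSpan, prodSpan_powersetCard_of_zero (e := e) (projAlong_self hi)]

/-- Independence of a set containing `e` is independence of the rest modulo the vector of `e`. -/
lemma linearIndepOn_insert_iff_projAlong {a : E → V → K} {e : E} {i₀ : V} (hi : a e i₀ ≠ 0)
    {J : Set E} (he : e ∉ J) :
    LinearIndepOn K a (insert e J) ↔ LinearIndepOn K (fun e' => projAlong (a e) i₀ (a e')) J := by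
  have hker := ker_projAlong hi
  have hne : a e ≠ 0 := Function.ne_iff.2 ⟨i₀, hi⟩
  rw [linearIndepOn_insert he]
  constructor
  · rintro ⟨h1, h2⟩
    refine LinearIndependent.map h1 ?_
    rw [hker, ← Set.image_eq_range]
    exact (Submodule.disjoint_span_singleton' hne).2 h2
  · intro h
    have h1 : LinearIndepOn K a J := LinearIndependent.of_comp (projAlong (a e) i₀) h
    refine ⟨h1, fun hm => hne ?_⟩
    obtain ⟨l, hl, hl'⟩ := (Finsupp.mem_span_image_iff_linearCombination K).1 hm
    have h2 : l = 0 := by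
      refine linearIndepOn_iff.1 h l hl ?_
      have := congrArg (projAlong (a e) i₀) hl'
      rw [projAlong_self hi, Finsupp.apply_linearCombination] at this
      exact this
    rw [← hl', h2, map_zero]

lemma prodSpan_empty (a : E → V → K) : prodSpan ∅ a = ⊥ := by
  simp [prodSpan]

lemma finrank_prodSpan_powersetCard_zero (s : Finset E) (a : E → V → K) :
    Module.finrank K (prodSpan (Finset.powersetCard 0 s) a) = 1 := by
  rw [prodSpan, Finset.powersetCard_zero, Finset.coe_singleton, Set.image_singleton]
  exact finrank_span_singleton (by simp [formProd])

/-- A dimension which obeys deletion and contraction depends only on the independent sets. -/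
theorem finrank_prodSpan_powersetCard_congr {W : Type*} [Fintype W] [Infinite K] (s : Finset E) :
    ∀ (a : E → V → K) (b : E → W → K),
      (∀ I : Set E, I ⊆ s → (LinearIndepOn K a I ↔ LinearIndepOn K b I)) →
      ∀ k, Module.finrank K (prodSpan (Finset.powersetCard k s) a) =
        Module.finrank K (prodSpan (Finset.powersetCard k s) b) := by
  classical
  induction s using Finset.induction with
  | empty =>
    rintro a b - (_ | k)
    · rw [finrank_prodSpan_powersetCard_zero, finrank_prodSpan_powersetCard_zero]
    · have h : Finset.powersetCard (k + 1) (∅ : Finset E) = ∅ :=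
        Finset.powersetCard_eq_empty.2 (by simp)
      rw [h, prodSpan_empty, prodSpan_empty, finrank_bot, finrank_bot]
  | insert e s he ih =>
    intro a b hab k
    have hs : (s : Set E) ⊆ (insert e s : Finset E) := by simp
    have hae : a e ≠ 0 ↔ b e ≠ 0 := by
      have := hab {e} (by simp)
      rwa [linearIndepOn_singleton_iff, linearIndepOn_singleton_iff] at this
    by_cases ha : a e = 0
    · have hb : b e = 0 := by by_contra h; exact hae.2 h ha
      rw [prodSpan_powersetCard_of_zero ha, prodSpan_powersetCard_of_zero hb]
      exact ih a b (fun I hI => hab I (hI.trans hs)) k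
    · obtain ⟨i, hi⟩ := Function.ne_iff.1 ha
      obtain ⟨j, hj⟩ := Function.ne_iff.1 (hae.1 ha)
      -- Multiplication by a form raises the degree, so the recursion starts in degree one; degree
      -- zero consists of the constants.
      rcases k with _ | k
      · rw [finrank_prodSpan_powersetCard_zero, finrank_prodSpan_powersetCard_zero]
      · rw [finrank_prodSpan_powersetCard_insert he hi, finrank_prodSpan_powersetCard_insert he hj]
        congr 1
        · exact ih a b (fun I hI => hab I (hI.trans hs)) k
        · refine ih _ _ (fun I hI => ?_) (k + 1)
          have heI : e ∉ I := fun h => he (hI h)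
          rw [← linearIndepOn_insert_iff_projAlong hi heI,
            ← linearIndepOn_insert_iff_projAlong hj heI]
          exact hab _ (by rw [Finset.coe_insert]; exact Set.insert_subset_insert hI)

open Classical in
/-- The dimension of the span of all products of linear forms is the number of independent sets. -/
theorem finrank_prodSpan_powerset [Infinite K] (s : Finset E) : ∀ a : E → V → K,
    Module.finrank K (prodSpan s.powerset a) =
      (s.powerset.filter fun I : Finset E => LinearIndepOn K a (I : Set E)).card := by
  induction s using Finset.induction with
  | empty =>
    intro a
    rw [prodSpan, Finset.powerset_empty, Finset.coe_singleton, Set.image_singleton,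
      finrank_span_singleton (by simp [formProd]), Finset.filter_singleton]
    simp
  | insert e s he ih =>
    intro a
    -- Independent sets avoiding `e` belong to the deletion; those containing `e` correspond to
    -- independent sets of the contraction, and there are none if `a e = 0`.
    rw [Finset.powerset_insert, Finset.filter_union, Finset.card_union_of_disjoint, ← ih a,
      Finset.filter_image, Finset.card_image_of_injOn, ← Finset.powerset_insert]
    · by_cases ha : a e = 0
      · have h : (s.powerset.filter fun I : Finset E =>
            LinearIndepOn K a ((insert e I : Finset E) : Set E)) = ∅ :=
          Finset.filter_eq_empty_iff.2 fun I _ hI => hI.ne_zero (by simp) ha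
        rw [prodSpan_powerset_of_zero ha, h, Finset.card_empty, add_zero]
      · obtain ⟨i, hi⟩ := Function.ne_iff.1 ha
        rw [finrank_prodSpan_insert he hi, ih fun e' => projAlong (a e) i (a e')]
        congr 1
        refine congrArg Finset.card (Finset.filter_congr fun I hI => ?_)
        rw [Finset.coe_insert, linearIndepOn_insert_iff_projAlong hi]
        exact fun h => he (Finset.mem_powerset.1 hI h)
    · intro I hI J hJ hIJ
      have hI' : e ∉ I := fun h => he (Finset.mem_powerset.1 (Finset.mem_filter.1 hI).1 h)
      have hJ' : e ∉ J := fun h => he (Finset.mem_powerset.1 (Finset.mem_filter.1 hJ).1 h)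
      rw [← Finset.erase_insert hI', ← Finset.erase_insert hJ']
      exact congrArg (fun S => Finset.erase S e) hIJ
    · rw [Finset.disjoint_left]
      intro I hI hI'
      obtain ⟨J, -, rfl⟩ := Finset.mem_image.1 (Finset.mem_filter.1 hI').1
      exact he (Finset.mem_powerset.1 (Finset.mem_filter.1 hI).1 (Finset.mem_insert_self e J))

end ZonotopalDimension

/-! ### Duality between the circulation algebra and products of column forms. -/

section Duality

open MvPolynomial

variable {K : Type*} [Field K] {V E : Type*}

/-- The exponent of the square-free monomial of `S`. -/
noncomputable def indicatorExponent (S : Finset E) : E →₀ ℕ := ∑ e ∈ S, Finsupp.single e 1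

lemma indicatorExponent_apply [DecidableEq E] (S : Finset E) (e : E) :
    indicatorExponent S e = if e ∈ S then 1 else 0 := by
  simp [indicatorExponent, Finsupp.finsetSum_apply, Finsupp.single_apply]

lemma degree_indicatorExponent (S : Finset E) : (indicatorExponent S).degree = S.card := by
  simp [indicatorExponent, map_sum]

lemma mem_squareIdeal_iff {p : MvPolynomial E K} :
    p ∈ squareIdeal K E ↔ ∀ m ∈ p.support, ∃ e, 2 ≤ m e := by
  have : (Set.range fun e : E => (X e : MvPolynomial E K) ^ 2) =
      (fun s => monomial s (1 : K)) '' Set.range fun e : E => Finsupp.single e 2 := by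
    rw [← Set.range_comp]
    congr 1
    funext e
    simp [X_pow_eq_monomial]
  rw [squareIdeal, this, mem_ideal_span_monomial_image]
  simp [Finsupp.single_le_iff]

/-- The coefficient of the square-free monomial of `S`. -/
noncomputable def squareFreeCoeff (S : Finset E) : SquareFreeAlgebra K E →ₗ[K] K :=
  (Submodule.liftQ ((squareIdeal K E).restrictScalars K) (lcoeff K (indicatorExponent S)) (by
    classical
    intro p hp
    rw [LinearMap.mem_ker]
    change coeff _ p = 0
    by_contra h
    obtain ⟨e, he⟩ := mem_squareIdeal_iff.1 hp _ (mem_support_iff.2 h)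
    rw [indicatorExponent_apply] at he
    split_ifs at he <;> omega)).comp
  (Submodule.Quotient.restrictScalarsEquiv K (squareIdeal K E)).symm.toLinearMap

lemma squareFreeCoeff_mk (S : Finset E) (p : MvPolynomial E K) :
    squareFreeCoeff S (Ideal.Quotient.mkₐ K (squareIdeal K E) p) =
      coeff (indicatorExponent S) p := rfl

/-- An exponent with all entries below two is the indicator of its support, so the square-free
coefficients see everything outside the ideal. -/
lemma eq_zero_of_squareFreeCoeff {z : SquareFreeAlgebra K E}
    (h : ∀ S, squareFreeCoeff S z = 0) : z = 0 := by
  classical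
  obtain ⟨p, rfl⟩ := Ideal.Quotient.mkₐ_surjective K (squareIdeal K E) z
  refine Ideal.Quotient.eq_zero_iff_mem.2 (mem_squareIdeal_iff.2 fun m hm => ?_)
  by_contra! hlt
  refine mem_support_iff.1 hm ?_
  have hms : m = indicatorExponent m.support := by
    ext e
    rw [indicatorExponent_apply]
    have := hlt e
    split_ifs with he
    · have := Finsupp.mem_support_iff.1 he; omega
    · exact Finsupp.notMem_support_iff.1 he
  rw [hms, ← squareFreeCoeff_mk]
  exact h _

lemma squareFreeCoeff_x_mul [DecidableEq E] (S : Finset E) (e : E) (z : SquareFreeAlgebra K E) :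
    squareFreeCoeff S (SquareFreeAlgebra.x K e * z) =
      if e ∈ S then squareFreeCoeff (S.erase e) z else 0 := by
  obtain ⟨p, rfl⟩ := Ideal.Quotient.mkₐ_surjective K (squareIdeal K E) z
  rw [SquareFreeAlgebra.x, ← map_mul, squareFreeCoeff_mk, squareFreeCoeff_mk, coeff_X_mul']
  have hmem : e ∈ (indicatorExponent S).support ↔ e ∈ S := by
    rw [Finsupp.mem_support_iff, indicatorExponent_apply]; simp
  simp only [hmem]
  split_ifs with he
  · congr 1
    rw [indicatorExponent, indicatorExponent, ← Finset.add_sum_erase S _ he, add_tsub_cancel_left]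
  · rfl

open Classical in
lemma squareFreeCoeff_one (S : Finset E) :
    squareFreeCoeff S (1 : SquareFreeAlgebra K E) = if S = ∅ then 1 else 0 := by
  rw [← map_one (Ideal.Quotient.mkₐ K (squareIdeal K E)), squareFreeCoeff_mk, coeff_one]
  congr 1
  rw [eq_iff_iff]
  constructor
  · intro h
    rw [← Finset.card_eq_zero, ← degree_indicatorExponent, ← h, map_zero]
  · rintro rfl; rfl

lemma squareFreeCoeff_of_mem_degreePart {k : ℕ} {z : SquareFreeAlgebra K E}
    (hz : z ∈ SquareFreeAlgebra.degreePart K E k) {S : Finset E} (hS : S.card ≠ k) :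
    squareFreeCoeff S z = 0 := by
  obtain ⟨p, hp, rfl⟩ := hz
  rw [AlgHom.toLinearMap_apply, squareFreeCoeff_mk]
  refine IsHomogeneous.coeff_eq_zero (n := k) hp ?_
  rwa [degree_indicatorExponent]

variable [Fintype E] [Fintype V]

/-- The presentation of the circulation algebra by polynomials in the rows of `A`. -/
noncomputable def circulationHom (A : Matrix V E K) :
    MvPolynomial V K →ₐ[K] SquareFreeAlgebra K E :=
  aeval fun v => ∑ e, A v e • SquareFreeAlgebra.x K e

lemma range_circulationHom (A : Matrix V E K) :
    (circulationHom A).range = circulationAlgebra A :=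
  (Algebra.adjoin_range_eq_range_aeval K _).symm

lemma circulationHom_mem_degreePart (A : Matrix V E K) {k : ℕ} {p : MvPolynomial V K}
    (hp : p.IsHomogeneous k) : circulationHom A p ∈ SquareFreeAlgebra.degreePart K E k := by
  have h : circulationHom A = (Ideal.Quotient.mkₐ K (squareIdeal K E)).comp
      (aeval fun v => linForm (A v)) := by
    ext v
    simp [circulationHom, linForm, SquareFreeAlgebra.x, map_sum]
    rfl
  rw [h, AlgHom.comp_apply]
  refine Submodule.mem_map_of_mem (f := (Ideal.Quotient.mkₐ K (squareIdeal K E)).toLinearMap) ?_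
  rw [mem_homogeneousSubmodule]
  simpa using hp.aeval (fun v => linForm (A v)) (n := 1) fun v => linForm_isHomogeneous (A v)

lemma pderiv_linForm [DecidableEq V] (c : V → K) (v : V) : pderiv v (linForm c) = C (c v) := by
  simp [linForm, map_sum, pderiv_X, Pi.single_apply, smul_eq_C_mul]

lemma pderiv_formProd [DecidableEq E] (a : E → V → K) (v : V) (S : Finset E) :
    pderiv v (formProd a S) = ∑ e ∈ S, a e v • formProd a (S.erase e) := by
  classical
  induction S using Finset.induction with
  | empty => simp [formProd]
  | insert e s he ih =>
    rw [formProd_insert a he, Derivation.leibniz, ih, pderiv_linForm, Finset.sum_insert he,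
      Finset.erase_insert he, add_comm, smul_eq_mul, smul_eq_mul, mul_comm, ← smul_eq_C_mul,
      Finset.mul_sum]
    congr 1
    refine Finset.sum_congr rfl fun e' he' => ?_
    have hne : e ≠ e' := fun h => he (h ▸ he')
    rw [Finset.erase_insert_of_ne hne, formProd_insert a fun h => he (Finset.mem_of_mem_erase h),
      mul_smul_comm]

/-- The coefficients of the monomials in the rows of `A` are, up to factorials, those of the
products of the linear forms given by the columns of `A`. -/
lemma squareFreeCoeff_circulationHom_monomial (A : Matrix V E K) (n : ℕ) :
    ∀ m : V →₀ ℕ, m.degree = n → ∀ S : Finset E,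
      squareFreeCoeff S (circulationHom A (monomial m 1)) =
        (∏ v, ((m v).factorial : K)) * coeff m (formProd (fun e v => A v e) S) := by
  classical
  induction n with
  | zero =>
    intro m hm S
    rw [Finsupp.degree_eq_zero_iff] at hm
    subst hm
    rw [← C_apply, map_one, map_one, squareFreeCoeff_one]
    by_cases hS : S = ∅
    · simp [hS, formProd]
    · rw [if_neg hS, (formProd_isHomogeneous _ S).coeff_eq_zero]
      · simp
      · simpa [eq_comm] using hS
  | succ n ih =>
    intro m hm S
    obtain ⟨v, hv⟩ : ∃ v, m v ≠ 0 := by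
      by_contra! h
      have : m = 0 := Finsupp.ext h
      simp [this] at hm
    obtain ⟨m', rfl⟩ : ∃ m', m = m' + Finsupp.single v 1 :=
      ⟨m - Finsupp.single v 1, (tsub_add_cancel_of_le (by
        rw [Finsupp.single_le_iff]; omega)).symm⟩
    have hm' : m'.degree = n := by simpa using hm
    have hfac : ∏ w, (((m' + Finsupp.single v 1 : V →₀ ℕ) w).factorial : K) =
        (∏ w, ((m' w).factorial : K)) * (m' v + 1) := by
      have : ∀ w, (((m' + Finsupp.single v 1 : V →₀ ℕ) w).factorial : K) =
          (m' w).factorial * if w = v then (m' v + 1 : K) else 1 := by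
        intro w
        split_ifs with h
        · subst h
          simp [Nat.factorial_succ, mul_comm]
        · simp [Ne.symm h]
      rw [Finset.prod_congr rfl fun w _ => this w, Finset.prod_mul_distrib, Finset.prod_ite_eq' _ v,
        if_pos (Finset.mem_univ v)]
    have hmon : (monomial (m' + Finsupp.single v 1) 1 : MvPolynomial V K) =
        X v * monomial m' 1 := by
      rw [X, monomial_mul, one_mul, add_comm]
    have hX : circulationHom A (X v) = ∑ e, A v e • SquareFreeAlgebra.x K e := by
      simp [circulationHom]
    -- Both sides obey one recursion: multiplication by `y_v`, like differentiating the product with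
    -- respect to `X_v`, removes an element `e` of `S` with weight `A v e`. The factor `m' v + 1`
    -- produced by the derivative is the growth of the factorial.
    rw [hmon, map_mul, hX, Finset.sum_mul, map_sum, hfac, mul_assoc, mul_comm (m' v + 1 : K),
      ← coeff_pderiv, pderiv_formProd, coeff_sum, Finset.mul_sum]
    simp only [smul_mul_assoc, map_smul, squareFreeCoeff_x_mul, ih m' hm', smul_ite, smul_zero]
    rw [Finset.sum_ite_mem, Finset.univ_inter]
    refine Finset.sum_congr rfl fun e _ => ?_
    rw [coeff_smul, smul_eq_mul, smul_eq_mul]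
    ring

/-- The coefficients of the square-free monomials of the members of `𝒮`. -/
noncomputable def coeffMap (𝒮 : Finset (Finset E)) : SquareFreeAlgebra K E →ₗ[K] (𝒮 → K) :=
  LinearMap.pi fun S => squareFreeCoeff (S : Finset E)

/-- Under the dot product, `c` annihilates the coefficient vectors of the algebra exactly when the
combination of the products with coefficients `c` is zero: its coefficients are the pairings with
monomials divided by nonzero factorials. Both dimensions are therefore the size of `𝒮` minus that of
the same kernel. -/
theorem finrank_map_coeffMap [CharZero K] (A : Matrix V E K) (𝒮 : Finset (Finset E)) :
    Module.finrank K ((Subalgebra.toSubmodule (circulationAlgebra A)).map (coeffMap 𝒮)) =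
      Module.finrank K (prodSpan 𝒮 (fun e v => A v e)) := by
  classical
  set W := (Subalgebra.toSubmodule (circulationAlgebra A)).map (coeffMap 𝒮) with hW
  set Φ : (𝒮 → K) →ₗ[K] MvPolynomial V K :=
    Fintype.linearCombination K fun S : 𝒮 => formProd (fun e v => A v e) (S : Finset E) with hΦ
  have hrange : LinearMap.range Φ = prodSpan 𝒮 (fun e v => A v e) := by
    rw [hΦ, Fintype.range_linearCombination]
    unfold prodSpan
    rw [Set.image_eq_range]
    rfl
  have hann : W.dualAnnihilator = (LinearMap.ker Φ).map (dotProductEquiv K 𝒮).toLinearMap := by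
    ext f
    obtain ⟨c, rfl⟩ := (dotProductEquiv K 𝒮).surjective f
    rw [Submodule.mem_dualAnnihilator, ← LinearEquiv.coe_coe,
      Submodule.mem_map_equiv, LinearEquiv.coe_coe, LinearEquiv.symm_apply_apply,
      LinearMap.mem_ker]
    have key : ∀ m : V →₀ ℕ,
        dotProductEquiv K 𝒮 c (coeffMap 𝒮 (circulationHom A (monomial m 1))) =
          (∏ v, ((m v).factorial : K)) * coeff m (Φ c) := by
      intro m
      simp only [dotProductEquiv_apply_apply, dotProduct, coeffMap, LinearMap.pi_apply,
        squareFreeCoeff_circulationHom_monomial A _ m rfl, hΦ, Fintype.linearCombination_apply,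
        coeff_sum, coeff_smul, Finset.mul_sum, smul_eq_mul]
      exact Finset.sum_congr rfl fun _ _ => by ring
    have hmem : ∀ p, coeffMap 𝒮 (circulationHom A p) ∈ W := fun p =>
      Submodule.mem_map_of_mem (by
        rw [Subalgebra.mem_toSubmodule, ← range_circulationHom]; exact ⟨p, rfl⟩)
    constructor
    · intro h
      ext m
      have := key m
      rw [h _ (hmem _)] at this
      rw [coeff_zero]
      refine (mul_eq_zero.1 this.symm).resolve_left (Finset.prod_ne_zero_iff.2 fun v _ => ?_)
      exact_mod_cast (m v).factorial_ne_zero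
    · rintro h _ ⟨z, hz, rfl⟩
      rw [SetLike.mem_coe, Subalgebra.mem_toSubmodule, ← range_circulationHom] at hz
      obtain ⟨p, rfl⟩ := hz
      have h0 : (dotProductEquiv K 𝒮 c).comp
          ((coeffMap 𝒮).comp (circulationHom A).toLinearMap) = 0 := by
        refine MvPolynomial.linearMap_ext fun m => LinearMap.ext_ring ?_
        have := key m
        rw [h, coeff_zero, mul_zero] at this
        exact this
      exact DFunLike.congr_fun h0 p
  have h1 := Subspace.finrank_add_finrank_dualAnnihilator_eq W
  rw [hann, LinearEquiv.finrank_map_eq] at h1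
  have h2 := Φ.finrank_range_add_finrank_ker
  rw [hrange] at h2
  omega

lemma finrank_map_of_injOn {M N : Type*} [AddCommGroup M] [Module K M] [AddCommGroup N]
    [Module K N] (f : M →ₗ[K] N) (U : Submodule K M) (h : ∀ x ∈ U, f x = 0 → x = 0) :
    Module.finrank K (U.map f) = Module.finrank K U := by
  rw [← LinearMap.range_domRestrict]
  refine LinearMap.finrank_range_of_inj ?_
  rw [injective_iff_map_eq_zero]
  exact fun x hx => Subtype.ext (h x x.2 hx)

/-- The dimension of the circulation algebra is that of the span of the products of the linear
forms given by the columns. -/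
theorem finrank_circulationAlgebra [CharZero K] (A : Matrix V E K) :
    Module.finrank K (circulationAlgebra A) =
      Module.finrank K (prodSpan (Finset.univ : Finset E).powerset (fun e v => A v e)) := by
  rw [← finrank_map_coeffMap, finrank_map_of_injOn]
  · rfl
  · intro z _ hz
    exact eq_zero_of_squareFreeCoeff fun S =>
      congrFun hz ⟨S, Finset.mem_powerset.2 (Finset.subset_univ S)⟩

theorem finrank_circulationDegreePart [CharZero K] (A : Matrix V E K) (k : ℕ) :
    Module.finrank K (circulationDegreePart A k) =
      Module.finrank K
        (prodSpan (Finset.powersetCard k (Finset.univ : Finset E)) (fun e v => A v e)) := by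
  rw [← finrank_map_coeffMap,
    ← finrank_map_of_injOn (coeffMap (Finset.powersetCard k (Finset.univ : Finset E)))]
  · refine congrArg (fun U : Submodule K _ => Module.finrank K U) ?_
    apply le_antisymm (Submodule.map_mono inf_le_left)
    rintro _ ⟨z, hz, rfl⟩
    rw [SetLike.mem_coe, Subalgebra.mem_toSubmodule, ← range_circulationHom] at hz
    obtain ⟨p, rfl⟩ := hz
    -- The presentation preserves degrees, so replacing `p` by its component of degree `k` leaves
    -- the coefficients at sets of size `k` unchanged.
    refine ⟨circulationHom A (homogeneousComponent k p), ⟨?_, ?_⟩, ?_⟩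
    · rw [SetLike.mem_coe, Subalgebra.mem_toSubmodule, ← range_circulationHom]
      exact AlgHom.mem_range_self _ _
    · exact circulationHom_mem_degreePart A (homogeneousComponent_isHomogeneous k p)
    · funext S
      have hS : (S : Finset E).card = k := (Finset.mem_powersetCard.1 S.2).2
      change squareFreeCoeff (S : Finset E) (circulationHom A (homogeneousComponent k p)) =
        squareFreeCoeff (S : Finset E) (circulationHom A p)
      have hsum := congrArg (fun q => squareFreeCoeff (S : Finset E) (circulationHom A q))
        (sum_homogeneousComponent p)
      simp only [map_sum] at hsum
      rw [← hsum, Finset.sum_eq_single k (fun i _ hi => ?_) fun hk => ?_]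
      · exact squareFreeCoeff_of_mem_degreePart
          (circulationHom_mem_degreePart A (homogeneousComponent_isHomogeneous i p))
          (by rw [hS]; exact hi.symm)
      · rw [homogeneousComponent_eq_zero _ _ (by simpa using hk), map_zero, map_zero]
  · intro z hz h0
    refine eq_zero_of_squareFreeCoeff fun S => ?_
    by_cases hS : S.card = k
    · exact congrFun h0 ⟨S, Finset.mem_powersetCard.2 ⟨Finset.subset_univ S, hS⟩⟩
    · exact squareFreeCoeff_of_mem_degreePart hz.2 hS

end Duality

/-! ### Walks, paths and cycles in multigraphs. -/

namespace Graph

open Relation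

variable {α β : Type*} {G H : Graph α β}

/-- Two vertices are joined if there is a walk from one to the other. -/
def Joined (G : Graph α β) : α → α → Prop := ReflTransGen G.Adj

lemma Joined.symm {x y : α} (h : G.Joined x y) : G.Joined y x := by
  have : Std.Symm G.Adj := ⟨fun _ _ => Adj.symm⟩
  exact ReflTransGen.stdSymm.symm _ _ h

lemma Joined.mono (hGH : G ≤ H) {x y : α} (h : G.Joined x y) : H.Joined x y :=
  ReflTransGen.mono (fun _ _ (h : G.Adj _ _) => h.imp fun _ he => he.mono hGH) _ _ h

lemma Joined.trans {x y z : α} (h : G.Joined x y) (h' : G.Joined y z) : G.Joined x z :=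
  ReflTransGen.trans h h'

lemma IsLink.joined {e : β} {x y : α} (h : G.IsLink e x y) : G.Joined x y :=
  ReflTransGen.single h.adj

lemma joined_refl (G : Graph α β) (x : α) : G.Joined x x := ReflTransGen.refl

lemma component_isCycle_iff {x : α} {S : Set β} :
    (G.component x).IsCycle S ↔ ∃ (n : ℕ) (v : Fin (n + 1) → α) (e : Fin (n + 1) → β),
      Function.Injective v ∧ Function.Injective e ∧ (∀ i, G.IsLink (e i) (v i) (v (i + 1))) ∧
      (∀ i, G.Joined x (v i)) ∧ S = Set.range e := by
  constructor
  · rintro ⟨n, v, e, hv, he, hl, rfl⟩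
    exact ⟨n, v, e, hv, he, fun i => (hl i).1, fun i => (hl i).2.1, rfl⟩
  · rintro ⟨n, v, e, hv, he, hl, hj, rfl⟩
    exact ⟨n, v, e, hv, he, fun i => ⟨hl i, hj i, hj (i + 1)⟩, rfl⟩

lemma component_isCycle_mono (hGH : G ≤ H) {x : α} {S : Set β} (h : (G.component x).IsCycle S) :
    (H.component x).IsCycle S := by
  rw [component_isCycle_iff] at h ⊢
  obtain ⟨n, v, e, hv, he, hl, hj, rfl⟩ := h
  exact ⟨n, v, e, hv, he, fun i => (hl i).mono hGH, fun i => (hj i).mono hGH, rfl⟩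

lemma component_isCycle_of_joined {x y : α} (hxy : G.Joined x y) {S : Set β}
    (h : (G.component y).IsCycle S) : (G.component x).IsCycle S := by
  rw [component_isCycle_iff] at h ⊢
  obtain ⟨n, v, e, hv, he, hl, hj, rfl⟩ := h
  exact ⟨n, v, e, hv, he, hl, fun i => hxy.trans (hj i), rfl⟩

lemma subset_edgeSet_of_component_isCycle {x : α} {S : Set β} (h : (G.component x).IsCycle S) :
    S ⊆ E(G) := by
  obtain ⟨n, v, e, -, -, hl, -, rfl⟩ := component_isCycle_iff.1 h
  rintro _ ⟨i, rfl⟩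
  exact (hl i).edge_mem

lemma IsPseudoforest.mono (hGH : G ≤ H) (h : H.IsPseudoforest) : G.IsPseudoforest :=
  fun x hx _ _ hS hT => h x (hGH.vertexSet_mono hx) _ _ (component_isCycle_mono hGH hS)
    (component_isCycle_mono hGH hT)

/-- Joined vertices are joined by a path. -/
lemma Joined.exists_path [Nonempty β] {x y : α} (h : G.Joined x y) :
    ∃ (n : ℕ) (v : ℕ → α) (e : ℕ → β), v 0 = x ∧ v n = y ∧
      (∀ i < n, G.IsLink (e i) (v i) (v (i + 1))) ∧ Set.InjOn v (Set.Iic n) := by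
  induction h using ReflTransGen.head_induction_on with
  | refl =>
    exact ⟨0, fun _ => y, fun _ => Classical.arbitrary β, rfl, rfl, by simp, by simp [Set.InjOn]⟩
  | @head x w hxw _ ih =>
    obtain ⟨n, v, e, h0, hn, hl, hinj⟩ := ih
    obtain ⟨f, hf⟩ := hxw
    -- If the path already visits `x`, it is cut to start there; otherwise `x` is prepended.
    by_cases hx : ∃ k ≤ n, v k = x
    · obtain ⟨k, hk, rfl⟩ := hx
      refine ⟨n - k, fun i => v (i + k), fun i => e (i + k), by simp, ?_, ?_, ?_⟩
      · simp only [Nat.sub_add_cancel hk, hn]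
      · intro i hi
        have := hl (i + k) (by omega)
        rwa [add_right_comm] at this
      · intro i hi j hj hij
        simp only [Set.mem_Iic] at hi hj
        have := hinj (Set.mem_Iic.2 (by omega)) (Set.mem_Iic.2 (by omega)) hij
        omega
    · push Not at hx
      refine ⟨n + 1, fun i => i.casesOn x v, fun i => i.casesOn f e, rfl, hn, ?_, ?_⟩
      · rintro (_ | i) hi
        · simpa [h0] using hf
        · exact hl i (by omega)
      · rintro (_ | i) hi (_ | j) hj hij
        · rfl
        · simp only [Set.mem_Iic] at hj
          exact absurd hij.symm (hx j (by omega))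
        · simp only [Set.mem_Iic] at hi
          exact absurd hij (hx i (by omega))
        · simp only [Set.mem_Iic] at hi hj
          rw [hinj (Set.mem_Iic.2 (by omega)) (Set.mem_Iic.2 (by omega)) hij]

/-- An edge between joined vertices closes a cycle. -/
lemma exists_cycle_of_joined {F : Set β} {f : β} (hf : f ∉ F) {x y : α} (hl : G.IsLink f x y)
    (h : (G.restrict F).Joined x y) :
    ∃ S, f ∈ S ∧ ((G.restrict (insert f F)).component x).IsCycle S := by
  classical
  have : Nonempty β := ⟨f⟩
  obtain ⟨n, p, q, h0, hn, hq, hinj⟩ := h.exists_path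
  have hqF : ∀ i < n, q i ∈ F := fun i hi => (hq i hi).1
  have hqf : ∀ i < n, q i ≠ f := fun i hi hi' => hf (hi' ▸ hqF i hi)
  -- The path uses the edges with indices below `n`; the closing edge `f` has index `n` and returns
  -- to vertex `0`, which is `n + 1` cyclically.
  set E : Fin (n + 1) → β := fun i => if (i : ℕ) < n then q i else f with hE
  have hlast : E (Fin.last n) = f := by simp [hE]
  refine ⟨Set.range E, ⟨Fin.last n, hlast⟩, component_isCycle_iff.2
    ⟨n, fun i => p i, E, ?_, ?_, ?_, ?_, rfl⟩⟩
  · intro i j hij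
    exact Fin.ext (hinj (Set.mem_Iic.2 (Nat.lt_succ_iff.1 i.2))
      (Set.mem_Iic.2 (Nat.lt_succ_iff.1 j.2)) hij)
  · intro i j hij
    simp only [hE] at hij
    have hi := i.2
    have hj := j.2
    apply Fin.ext
    split_ifs at hij with h1 h2 h2
    · have hlj := hq j h2
      rw [← hij] at hlj
      -- An edge used twice in opposite directions would force `i = j + 1` and `i + 1 = j`.
      rcases (hq i h1).eq_and_eq_or_eq_and_eq hlj with ⟨h3, -⟩ | ⟨h3, h4⟩
      · exact hinj (Set.mem_Iic.2 (by omega)) (Set.mem_Iic.2 (by omega)) h3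
      · have h5 := hinj (Set.mem_Iic.2 (by omega)) (Set.mem_Iic.2 (by omega)) h3
        have h6 := hinj (Set.mem_Iic.2 (by omega)) (Set.mem_Iic.2 (by omega)) h4
        omega
    · exact absurd hij (hqf i h1)
    · exact absurd hij.symm (hqf j h2)
    · omega
  · intro i
    rcases Fin.eq_castSucc_or_eq_last i with ⟨i, rfl⟩ | rfl
    · have hi : E i.castSucc = q i := by simp [hE]
      rw [hi, Fin.coeSucc_eq_succ]
      exact ⟨Or.inr (hqF i i.2), (hq i i.2).2⟩
    · rw [hlast, Fin.last_add_one]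
      simp only [Fin.val_last, Fin.val_zero, h0, hn]
      exact ⟨Or.inl rfl, hl.symm⟩
  · intro i
    have : ∀ k ≤ n, (G.restrict F).Joined x (p k) := by
      intro k
      induction k with
      | zero => intro _; rw [h0]; exact joined_refl _ _
      | succ k ih => exact fun hk => (ih (by omega)).trans (hq k (by omega)).joined
    exact (this i (by omega)).mono (G.restrict_mono_right (Set.subset_insert f F))

open scoped Fin.NatCast Fin.CommRing in
/-- The ends of an edge of a cycle are joined by the rest of the cycle. -/
lemma joined_of_cycle {n : ℕ} {v : Fin (n + 1) → α} {e : Fin (n + 1) → β}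
    (he : Function.Injective e) (hl : ∀ i, G.IsLink (e i) (v i) (v (i + 1))) (k : Fin (n + 1)) :
    (G.restrict (Set.range e \ {e k})).Joined (v (k + 1)) (v k) := by
  have key : ∀ j : ℕ, j ≤ n →
      (G.restrict (Set.range e \ {e k})).Joined (v (k + 1)) (v (k + 1 + (j : Fin (n + 1)))) := by
    intro j
    induction j with
    | zero => intro _; simpa using joined_refl _ _
    | succ j ih =>
      intro hj
      refine (ih (by omega)).trans ?_
      have hlink := hl (k + 1 + (j : Fin (n + 1)))
      rw [add_assoc _ (j : Fin (n + 1)), ← Nat.cast_add_one] at hlink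
      refine IsLink.joined (e := e (k + 1 + (j : Fin (n + 1)))) ⟨⟨⟨_, rfl⟩, fun h => ?_⟩, hlink⟩
      -- Meeting `e k` again after `j + 1` steps would make `j + 1` a multiple of `n + 1`, but `j +
      -- 1 ≤ n`.
      have h1 := he h
      rw [add_assoc, add_eq_left, add_comm (1 : Fin (n + 1)), ← Nat.cast_add_one,
        Fin.natCast_eq_zero] at h1
      exact absurd (Nat.le_of_dvd (by omega) h1) (by omega)
  have := key n le_rfl
  rwa [add_assoc, add_comm (1 : Fin (n + 1)), ← Nat.cast_add_one, Fin.natCast_self, add_zero]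
    at this

end Graph

/-! ### Potentials on cycles; independent columns form pseudoforests. -/

namespace Graph

variable {α β : Type*} {G : Graph α β} {K : Type*} [Field K] {γ : β → K}

lemma isLink_ends (σ : G.Orientation) (f : E(G)) {x y : α} (h : G.IsLink f x y) :
    (σ.tail f : α) = x ∧ (σ.head f : α) = y ∨ (σ.tail f : α) = y ∧ (σ.head f : α) = x :=
  (σ.isLink f).eq_and_eq_or_eq_and_eq h

lemma eq_zero_iff_of_isLink (hγ : ∀ e ∈ E(G), γ e ≠ 0) (σ : G.Orientation) {Q : Type*}
    [AddCommGroup Q] [Module K Q] {d : α → Q} {f : E(G)}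
    (hd : d (σ.tail f) = γ f • d (σ.head f)) {x y : α} (h : G.IsLink f x y) :
    d x = 0 ↔ d y = 0 := by
  have hf := hγ f f.2
  rcases isLink_ends σ f h with ⟨h1, h2⟩ | ⟨h1, h2⟩ <;> rw [h1, h2] at hd <;> rw [hd] <;> simp [hf]

open scoped Fin.NatCast Fin.CommRing in
/-- A cycle with generic gains is unbalanced: it carries no nonzero potential. -/
lemma potential_eq_zero_of_cycle (hγ : ∀ e ∈ E(G), γ e ≠ 0) (hgen : G.GenericGains γ)
    (σ : G.Orientation) {Q : Type*} [AddCommGroup Q] [Module K Q] (d : α → Q) {n : ℕ}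
    {v : Fin (n + 1) → α} {e : Fin (n + 1) → β} (hv : Function.Injective v)
    (he : Function.Injective e) (hl : ∀ i, G.IsLink (e i) (v i) (v (i + 1)))
    (hd : ∀ f : E(G), (f : β) ∈ Set.range e → d (σ.tail f) = γ f • d (σ.head f)) :
    d (v 0) = 0 := by
  classical
  -- `P` is defined by the equation that holds rather than by the direction of the edge, so loops
  -- need no separate case; outside `P` the edge must run backwards and contributes `γ⁻¹`.
  set P : Finset (Fin (n + 1)) := {i | d (v i) = γ (e i) • d (v (i + 1))} with hP
  set g : Fin (n + 1) → K := fun i => if i ∈ P then γ (e i) else (γ (e i))⁻¹ with hg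
  have hγe : ∀ i, γ (e i) ≠ 0 := fun i => hγ _ (hl i).edge_mem
  have hstep : ∀ i, d (v i) = g i • d (v (i + 1)) := by
    intro i
    by_cases hi : i ∈ P
    · simp only [hg, if_pos hi]
      exact (Finset.mem_filter.1 hi).2
    · simp only [hg, if_neg hi]
      have h1 := hd ⟨e i, (hl i).edge_mem⟩ ⟨i, rfl⟩
      rcases isLink_ends σ ⟨e i, (hl i).edge_mem⟩ (hl i) with ⟨h2, h3⟩ | ⟨h2, h3⟩
      · rw [h2, h3] at h1
        exact absurd (Finset.mem_filter.2 ⟨Finset.mem_univ i, h1⟩) hi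
      · rw [h2, h3] at h1
        rw [h1, smul_smul, inv_mul_cancel₀ (hγe i), one_smul]
  have hwalk : ∀ k : ℕ, d (v 0) =
      (∏ j ∈ Finset.range k, g (j : Fin (n + 1))) • d (v (k : Fin (n + 1))) := by
    intro k
    induction k with
    | zero => simp
    | succ k ih =>
      rw [ih, Finset.prod_range_succ, mul_smul, hstep (k : Fin (n + 1)), ← Nat.cast_add_one]
  have hround := hwalk (n + 1)
  rw [Fin.natCast_self, Finset.prod_range] at hround
  simp only [Fin.cast_val_eq_self] at hround
  by_contra h0
  have hprod : ∏ i, g i = 1 := by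
    have : (∏ i, g i - 1) • d (v 0) = 0 := by rw [sub_smul, one_smul, ← hround, sub_self]
    exact sub_eq_zero.1 ((smul_eq_zero.1 this).resolve_right h0)
  refine hgen (Finset.univ.image e) ⟨n, v, e, hv, he, hl, by simp⟩ (P.image e)
    (Finset.image_subset_image (Finset.subset_univ P)) ?_
  rw [← Finset.image_sdiff _ _ he, Finset.prod_image he.injOn, Finset.prod_image he.injOn]
  have hsplit : ∏ i, g i = (∏ i ∈ P, γ (e i)) * (∏ i ∈ Finset.univ \ P, γ (e i))⁻¹ := by
    rw [← Finset.prod_sdiff (Finset.subset_univ P), mul_comm, ← Finset.prod_inv_distrib]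
    congr 1
    · exact Finset.prod_congr rfl fun i hi => by simp only [hg, if_pos hi]
    · exact Finset.prod_congr rfl fun i hi => by
        simp only [hg, if_neg (Finset.mem_sdiff.1 hi).2]
  rw [hsplit] at hprod
  exact (mul_inv_eq_one₀ (Finset.prod_ne_zero_iff.2 fun i _ => hγe i)).1 hprod

/-- The column of the edge `e` in the incidence matrix of the gain graph. -/
noncomputable def gainColumn (G : Graph α β) (σ : G.Orientation) (γ : β → K) (e : E(G)) :
    V(G) → K := fun v => G.gainMatrix σ γ v e

open Classical in
lemma gainColumn_eq (σ : G.Orientation) (γ : β → K) (e : E(G)) :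
    G.gainColumn σ γ e = γ e • Pi.single (σ.head e) 1 - Pi.single (σ.tail e) 1 := by
  funext v
  simp only [gainColumn, gainMatrix, Pi.sub_apply, Pi.smul_apply, Pi.single_apply, smul_eq_mul,
    eq_comm (a := v)]
  split_ifs <;> simp

variable [Finite V(G)]

/-- Distinct cycles in one component make the columns dependent. -/
lemma mem_of_linearIndepOn (hγ : ∀ e ∈ E(G), γ e ≠ 0) (hgen : G.GenericGains γ)
    (σ : G.Orientation) {I : Set E(G)} (hI : LinearIndepOn K (G.gainColumn σ γ) I) {x : α}
    {S T : Set β} (hS : ((G.restrict (Subtype.val '' I)).component x).IsCycle S)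
    (hT : ((G.restrict (Subtype.val '' I)).component x).IsCycle T) : S ⊆ T := by
  classical
  intro f hfS
  by_contra hfT
  obtain ⟨nT, vT, eT, hvT, heT, hlT, hjT, rfl⟩ := component_isCycle_iff.1 hT
  obtain ⟨nS, vS, eS, hvS, heS, hlS, hjS, rfl⟩ := component_isCycle_iff.1 hS
  obtain ⟨k, rfl⟩ := hfS
  obtain ⟨f, hfI, hfk⟩ := (hlS k).1
  set W := Submodule.span K (G.gainColumn σ γ '' (I \ {f})) with hW
  have hfW : G.gainColumn σ γ f ∉ W := by
    have := hI
    rw [← Set.insert_sdiff_self_of_mem hfI, linearIndepOn_insert (by simp)] at this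
    exact this.2
  -- The classes of the basis vectors modulo the columns of `I \ {f}` form a potential on these
  -- edges with values in the quotient; the value off `V(G)` is irrelevant.
  set d : α → (V(G) → K) ⧸ W := fun y => if h : y ∈ V(G) then W.mkQ (Pi.single ⟨y, h⟩ 1) else 0
    with hd
  have hdV : ∀ y : V(G), d y = W.mkQ (Pi.single y 1) := fun y => by simp [hd]
  have hcol : ∀ g : E(G), W.mkQ (G.gainColumn σ γ g) = γ g • d (σ.head g) - d (σ.tail g) := by
    intro g
    rw [gainColumn_eq, map_sub, map_smul, hdV, hdV]
  have hbal : ∀ g ∈ I \ {f}, d (σ.tail g) = γ g • d (σ.head g) := by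
    intro g hg
    have h0 : W.mkQ (G.gainColumn σ γ g) = 0 :=
      (Submodule.Quotient.mk_eq_zero W).2 (Submodule.subset_span ⟨g, hg, rfl⟩)
    rw [hcol, sub_eq_zero] at h0
    exact h0.symm
  have hstep : ∀ y z, (G.restrict (Subtype.val '' I \ {eS k})).Joined y z →
      (d y = 0 ↔ d z = 0) := by
    intro y z h
    induction h with
    | refl => rfl
    | tail _ h ih =>
      obtain ⟨e, ⟨⟨g, hg, rfl⟩, hne⟩, hl⟩ := h
      refine ih.trans (eq_zero_iff_of_isLink hγ σ (hbal g ⟨hg, fun h => hne ?_⟩) hl)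
      rw [h, ← hfk]; rfl
  -- Since `f` lies on the cycle `S`, removing it does not disconnect the component, so vanishing of
  -- `d` still spreads through all of it.
  have hk : d (vS (k + 1)) = 0 ↔ d (vS k) = 0 := by
    refine hstep _ _ ((joined_of_cycle heS (fun i => (hlS i).2) k).mono
      (G.restrict_mono_right (Set.sdiff_subset_sdiff_left ?_)))
    rintro _ ⟨i, rfl⟩
    exact (hlS i).1
  have hall : ∀ y z, (G.restrict (Subtype.val '' I)).Joined y z → (d y = 0 ↔ d z = 0) := by
    intro y z h
    induction h with
    | refl => rfl
    | @tail y z _ h ih =>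
      refine ih.trans ?_
      obtain ⟨e, heI, hl⟩ := h
      by_cases hek : e = eS k
      · subst hek
        rcases hl.eq_and_eq_or_eq_and_eq (hlS k).2 with ⟨rfl, rfl⟩ | ⟨rfl, rfl⟩
        · exact hk.symm
        · exact hk
      · exact hstep _ _ (IsLink.joined ⟨⟨heI, hek⟩, hl⟩)
  -- The cycle `T` avoids `f`, so `d` vanishes on it and then at both ends of `f`. This puts the
  -- column of `f` in `W`, against independence.
  have hT0 : d (vT 0) = 0 := by
    refine potential_eq_zero_of_cycle hγ hgen σ d hvT heT (fun i => (hlT i).2) fun g hg => ?_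
    refine hbal g ⟨?_, ?_⟩
    · obtain ⟨i, hi⟩ := hg
      obtain ⟨g', hg', h⟩ := (hlT i).1
      rwa [← Subtype.ext (h.trans hi)]
    · rintro rfl
      exact hfT (hfk ▸ hg)
  have hzero : ∀ y, (G.restrict (Subtype.val '' I)).Joined x y → d y = 0 := fun y hy =>
    (hall _ _ hy).1 ((hall _ _ (hjT 0)).2 hT0)
  have h1 := hzero _ (hjS k)
  have h2 := hk.2 h1
  have h3 : d (σ.tail f) = 0 ∧ d (σ.head f) = 0 := by
    rcases isLink_ends σ f (hfk ▸ (hlS k).2) with ⟨h, h'⟩ | ⟨h, h'⟩ <;> rw [h, h']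
    · exact ⟨h1, h2⟩
    · exact ⟨h2, h1⟩
  apply hfW
  rw [← Submodule.Quotient.mk_eq_zero W, ← Submodule.mkQ_apply, hcol, h3.1, h3.2, smul_zero,
    sub_zero]

end Graph

/-! ### Potentials on acyclic components; pseudoforests are independent and form a matroid. -/

namespace Graph

variable {α β : Type*} {G : Graph α β} {K : Type*} [Field K] {γ : β → K}

lemma isLink_restrict_insert {F : Set β} {f e : β} {u w x y : α} (hf : G.IsLink f u w)
    (h : (G.restrict (insert f F)).IsLink e x y) :
    (x = u ∧ y = w ∨ x = w ∧ y = u) ∨ (G.restrict F).IsLink e x y := by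
  obtain ⟨rfl | he, hl⟩ := h
  · exact Or.inl (hl.eq_and_eq_or_eq_and_eq hf)
  · exact Or.inr ⟨he, hl⟩

lemma restrict_le_restrict_insert (G : Graph α β) (F : Set β) (f : β) :
    G.restrict F ≤ G.restrict (insert f F) :=
  G.restrict_mono_right (Set.subset_insert f F)

lemma joined_insert {F : Set β} {f : β} {u w : α} (hf : G.IsLink f u w) :
    (G.restrict (insert f F)).Joined u w :=
  IsLink.joined (e := f) ⟨Set.mem_insert f F, hf⟩

lemma joined_insert_iff {F : Set β} {f : β} {u w : α} (hf : G.IsLink f u w) {y : α} :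
    (G.restrict (insert f F)).Joined u y ↔
      (G.restrict F).Joined u y ∨ (G.restrict F).Joined w y := by
  have hle := G.restrict_le_restrict_insert F f
  constructor
  · intro h
    induction h with
    | refl => exact Or.inl (joined_refl _ _)
    | tail _ h ih =>
      obtain ⟨e, h⟩ := h
      rcases isLink_restrict_insert hf h with (⟨-, rfl⟩ | ⟨-, rfl⟩) | h
      · exact Or.inr (joined_refl _ _)
      · exact Or.inl (joined_refl _ _)
      · exact ih.imp (fun h' => h'.trans h.joined) (fun h' => h'.trans h.joined)
  · rintro (h | h)
    · exact h.mono hle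
    · exact (joined_insert hf).trans (h.mono hle)

lemma joined_insert_iff_of_not_joined {F : Set β} {f : β} {u w x : α} (hf : G.IsLink f u w)
    (hx : ¬ (G.restrict (insert f F)).Joined x u) {y : α} :
    (G.restrict (insert f F)).Joined x y ↔ (G.restrict F).Joined x y := by
  refine ⟨fun h => ?_, fun h => h.mono (G.restrict_le_restrict_insert F f)⟩
  induction h with
  | refl => exact joined_refl _ _
  | tail h' h ih =>
    obtain ⟨e, h⟩ := h
    rcases isLink_restrict_insert hf h with (⟨rfl, -⟩ | ⟨rfl, -⟩) | h
    · exact absurd h' hx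
    · exact absurd (Joined.trans h' (joined_insert hf).symm) hx
    · exact ih.trans h.joined

/-- An acyclic component carries a potential which vanishes exactly outside of it. -/
lemma exists_potential (hγ : ∀ e ∈ E(G), γ e ≠ 0) (σ : G.Orientation) {I : Set E(G)}
    (hI : I.Finite) : ∀ x, (∀ S, ¬ ((G.restrict (Subtype.val '' I)).component x).IsCycle S) →
      ∃ p : α → K, (∀ f ∈ I, p (σ.tail f) = γ f * p (σ.head f)) ∧
        ∀ y, p y ≠ 0 ↔ (G.restrict (Subtype.val '' I)).Joined x y := by
  classical
  induction I, hI using Set.Finite.induction_on with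
  | empty =>
    intro x _
    refine ⟨fun y => if y = x then 1 else 0, by simp, fun y => ?_⟩
    have : (G.restrict (Subtype.val '' (∅ : Set E(G)))).Joined x y ↔ y = x := by
      constructor
      · intro h
        cases h with
        | refl => rfl
        | tail _ h =>
          obtain ⟨e, he, -⟩ := h
          simp at he
      · rintro rfl
        exact joined_refl _ _
    rw [this]
    simp
  | @insert e I he _ ih =>
    intro x hx
    rw [Set.image_insert_eq] at hx ⊢
    set F : Set β := Subtype.val '' I with hF
    have heF : (e : β) ∉ F := by
      rintro ⟨e', he', h⟩
      exact he (Subtype.ext h ▸ he')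
    have hl := σ.isLink e
    have hle := G.restrict_le_restrict_insert F e
    by_cases hxu : (G.restrict (insert (e : β) F)).Joined x (σ.tail e)
    · have hu : ∀ S, ¬ ((G.restrict F).component (σ.tail e : α)).IsCycle S := fun S hS =>
        hx S (component_isCycle_of_joined hxu (component_isCycle_mono hle hS))
      have hw : ∀ S, ¬ ((G.restrict F).component (σ.head e : α)).IsCycle S := fun S hS =>
        hx S (component_isCycle_of_joined (hxu.trans (joined_insert hl))
          (component_isCycle_mono hle hS))
      have huw : ¬ (G.restrict F).Joined (σ.tail e) (σ.head e) := fun h => by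
        obtain ⟨S, -, hS⟩ := exists_cycle_of_joined heF hl h
        exact hx S (component_isCycle_of_joined hxu hS)
      -- Without `e` the component splits into two acyclic ones, those of the tail and of the head,
      -- with potentials `p` and `q` of disjoint supports.
      obtain ⟨p, hp, hp'⟩ := ih _ hu
      obtain ⟨q, hq, hq'⟩ := ih _ hw
      have hpu : p (σ.tail e) ≠ 0 := (hp' _).2 (joined_refl _ _)
      have hqw : q (σ.head e) ≠ 0 := (hq' _).2 (joined_refl _ _)
      have hpw : p (σ.head e) = 0 := by
        by_contra h; exact huw ((hp' _).1 h)
      have hqu : q (σ.tail e) = 0 := by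
        by_contra h; exact huw ((hq' _).1 h).symm
      have hγe := hγ e e.2
      -- As `q` vanishes at the tail and `p` at the head, the equation at `e` for `p + s q` reads
      -- `p(tail) = γ(e) s q(head)`, which determines `s`.
      set s := p (σ.tail e) / (γ e * q (σ.head e)) with hs
      have hs0 : s ≠ 0 := div_ne_zero hpu (mul_ne_zero hγe hqw)
      refine ⟨fun y => p y + s * q y, ?_, fun y => ?_⟩
      · rintro f (rfl | hf)
        · simp only [hpw, hqu, hs]
          field_simp
          ring
        · simp only [hp f hf, hq f hf]
          ring
      · have h1 : (G.restrict (insert (e : β) F)).Joined x y ↔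
            (G.restrict (insert (e : β) F)).Joined (σ.tail e) y :=
          ⟨fun h => hxu.symm.trans h, fun h => hxu.trans h⟩
        rw [h1, joined_insert_iff hl, ← hp', ← hq']
        by_cases h2 : p y = 0
        · simp [h2, hs0]
        · have h3 : q y = 0 := by
            by_contra h3
            exact huw (((hp' y).1 h2).trans ((hq' y).1 h3).symm)
          simp [h2, h3]
    · have hxw : ¬ (G.restrict (insert (e : β) F)).Joined x (σ.head e) := fun h =>
        hxu (h.trans (joined_insert hl).symm)
      obtain ⟨p, hp, hp'⟩ := ih x fun S hS => hx S (component_isCycle_mono hle hS)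
      refine ⟨p, ?_, fun y => by rw [hp', joined_insert_iff_of_not_joined hl hxu]⟩
      rintro f (rfl | hf)
      · have h1 : p (σ.tail f) = 0 := by
          by_contra h; exact hxu (((hp' _).1 h).mono hle)
        have h2 : p (σ.head f) = 0 := by
          by_contra h; exact hxw (((hp' _).1 h).mono hle)
        rw [h1, h2, mul_zero]
      · exact hp f hf

variable [Finite V(G)]

/-- Pairing with `p` sends the column of `f` to `γ f * p(head) - p(tail)`, a functional that kills
the columns of `I` but not that of `e`. -/
lemma notMem_span_of_potential (σ : G.Orientation) {I : Set E(G)} {e : E(G)} (p : α → K)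
    (hp : ∀ f ∈ I, p (σ.tail f) = γ f * p (σ.head f))
    (he : p (σ.tail e) ≠ γ e * p (σ.head e)) :
    G.gainColumn σ γ e ∉ Submodule.span K (G.gainColumn σ γ '' I) := by
  classical
  have := Fintype.ofFinite V(G)
  set L : (V(G) → K) →ₗ[K] K := Fintype.linearCombination K fun v : V(G) => p v with hL
  have hcol : ∀ f, L (G.gainColumn σ γ f) = γ f * p (σ.head f) - p (σ.tail f) := by
    intro f
    rw [gainColumn_eq, map_sub, map_smul, hL, Fintype.linearCombination_apply_single,
      Fintype.linearCombination_apply_single]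
    simp
  intro hmem
  have hle : Submodule.span K (G.gainColumn σ γ '' I) ≤ LinearMap.ker L := by
    rw [Submodule.span_le]
    rintro _ ⟨f, hf, rfl⟩
    rw [SetLike.mem_coe, LinearMap.mem_ker, hcol, hp f hf, sub_self]
  have h0 := hle hmem
  rw [LinearMap.mem_ker, hcol, sub_eq_zero] at h0
  exact he h0.symm

/-- Edges are added one at a time. Each new edge has an end whose earlier component is acyclic, and
the potential supported on that component fails the equation at the new edge. -/
lemma linearIndepOn_of_isPseudoforest (hγ : ∀ e ∈ E(G), γ e ≠ 0) (hgen : G.GenericGains γ)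
    (σ : G.Orientation) {I : Set E(G)} (hI : I.Finite) :
    (G.restrict (Subtype.val '' I)).IsPseudoforest →
      LinearIndepOn K (G.gainColumn σ γ) I := by
  classical
  induction I, hI using Set.Finite.induction_on with
  | empty => exact fun _ => linearIndepOn_empty K _
  | @insert e I he hfin ih =>
    intro hpf
    rw [Set.image_insert_eq] at hpf
    set F : Set β := Subtype.val '' I with hF
    have heF : (e : β) ∉ F := by
      rintro ⟨e', he', h⟩
      exact he (Subtype.ext h ▸ he')
    have hl := σ.isLink e
    have hle := G.restrict_le_restrict_insert F e
    rw [linearIndepOn_insert he]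
    refine ⟨ih (hpf.mono hle), ?_⟩
    by_cases huw : (G.restrict F).Joined (σ.tail e) (σ.head e)
    · obtain ⟨S, heS, hS⟩ := exists_cycle_of_joined heF hl huw
      have hacyc : ∀ T, ¬ ((G.restrict F).component (σ.tail e : α)).IsCycle T := by
        intro T hT
        have hST := hpf _ (σ.tail e).2 S T hS (component_isCycle_mono hle hT)
        rw [hST] at heS
        exact heF ((subset_edgeSet_of_component_isCycle hT heS).2)
      obtain ⟨p, hp, hp'⟩ := exists_potential hγ σ hfin _ hacyc
      -- If `p` also satisfied the equation at `e`, it would be a potential on the cycle closed by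
      -- `e`, yet it is nonzero there.
      refine notMem_span_of_potential σ p hp fun h => ?_
      obtain ⟨n, v, c, hv, hc, hlc, hj, rfl⟩ := component_isCycle_iff.1 hS
      have h0 := potential_eq_zero_of_cycle hγ hgen σ p hv hc (fun i => (hlc i).2) fun f hf => by
        obtain ⟨i, hi⟩ := hf
        rcases (hlc i).1 with h1 | ⟨f', hf', h1⟩
        · rw [hi] at h1
          rw [Subtype.ext h1, h, smul_eq_mul]
        · rw [← Subtype.ext (h1.trans hi), hp f' hf', smul_eq_mul]
      refine (hp' (v 0)).2 ?_ h0
      rcases (joined_insert_iff hl).1 (hj 0) with h1 | h1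
      · exact h1
      · exact huw.trans h1
    -- Now `e` joins two different components, at most one of them with a cycle; a potential
    -- supported on an acyclic one is nonzero at exactly one end of `e`.
    · by_cases hu : ∃ S, ((G.restrict F).component (σ.tail e : α)).IsCycle S
      · have hw : ∀ T, ¬ ((G.restrict F).component (σ.head e : α)).IsCycle T := by
          intro T hT
          obtain ⟨S, hS⟩ := hu
          have hST := hpf _ (σ.tail e).2 S T (component_isCycle_mono hle hS)
            (component_isCycle_of_joined (joined_insert hl) (component_isCycle_mono hle hT))
          obtain ⟨n, v, c, -, -, hlc, hj, rfl⟩ := component_isCycle_iff.1 hS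
          obtain ⟨n', v', c', -, -, hlc', hj', rfl⟩ := component_isCycle_iff.1 hT
          -- If the cycles on the two sides coincided, a common edge would connect the two
          -- components without `e`.
          obtain ⟨i, hi⟩ : c 0 ∈ Set.range c' := hST ▸ Set.mem_range_self 0
          have hli := hlc' i
          rw [hi] at hli
          rcases (hlc 0).left_eq_or_eq hli with h | h
          · exact huw ((hj 0).trans (h ▸ (hj' i).symm))
          · exact huw ((hj 0).trans (h ▸ (hj' (i + 1)).symm))
        obtain ⟨p, hp, hp'⟩ := exists_potential hγ σ hfin _ hw
        refine notMem_span_of_potential σ p hp ?_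
        have h1 : p (σ.tail e) = 0 := by
          by_contra h; exact huw ((hp' _).1 h).symm
        rw [h1]
        exact (mul_ne_zero (hγ e e.2) ((hp' _).2 (joined_refl _ _))).symm
      · push Not at hu
        obtain ⟨p, hp, hp'⟩ := exists_potential hγ σ hfin _ hu
        refine notMem_span_of_potential σ p hp ?_
        have h1 : p (σ.head e) = 0 := by
          by_contra h; exact huw ((hp' _).1 h)
        rw [h1, mul_zero]
        exact (hp' _).2 (joined_refl _ _)

theorem linearIndepOn_gainColumn_iff [Finite E(G)] (hγ : ∀ e ∈ E(G), γ e ≠ 0)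
    (hgen : G.GenericGains γ) (σ : G.Orientation) (I : Set E(G)) :
    LinearIndepOn K (G.gainColumn σ γ) I ↔ (G.restrict (Subtype.val '' I)).IsPseudoforest :=
  ⟨fun hI _ _ _ _ hS hT => (mem_of_linearIndepOn hγ hgen σ hI hS hT).antisymm
    (mem_of_linearIndepOn hγ hgen σ hI hT hS),
    linearIndepOn_of_isPseudoforest hγ hgen σ I.toFinite⟩

/-- The augmentation property of linear independence. -/
lemma exists_linearIndepOn_insert {ι M : Type*} [Finite ι] [AddCommGroup M] [Module K M]
    {v : ι → M} {I J : Set ι} (hI : LinearIndepOn K v I) (hJ : LinearIndepOn K v J)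
    (hlt : I.ncard < J.ncard) : ∃ e ∈ J, e ∉ I ∧ LinearIndepOn K v (insert e I) := by
  classical
  have := Fintype.ofFinite ι
  have hrank : ∀ {L : Set ι}, LinearIndepOn K v L →
      Module.finrank K (Submodule.span K (v '' L)) = L.ncard := by
    intro L hL
    rw [Set.image_eq_range, finrank_span_eq_card hL, Set.ncard_eq_toFinset_card',
      Set.toFinset_card]
  by_contra! hcon
  have hle : Submodule.span K (v '' J) ≤ Submodule.span K (v '' I) := by
    rw [Submodule.span_le]
    rintro _ ⟨e, he, rfl⟩
    by_cases heI : e ∈ I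
    · exact Submodule.subset_span ⟨e, heI, rfl⟩
    · by_contra hspan
      exact hcon e he heI ((linearIndepOn_insert heI).2 ⟨hI, hspan⟩)
  have : FiniteDimensional K (Submodule.span K (v '' I)) :=
    FiniteDimensional.span_of_finite K (I.toFinite.image v)
  have := Submodule.finrank_mono hle
  rw [hrank hI, hrank hJ] at this
  omega

lemma nonempty_orientation (G : Graph α β) : Nonempty G.Orientation := by
  choose t h hl using fun e : E(G) => exists_isLink_of_mem_edgeSet e.2
  exact ⟨⟨fun e => ⟨t e, (hl e).left_mem⟩, fun e => ⟨h e, (hl e).right_mem⟩, hl⟩⟩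

/-- The spanning pseudoforests are the independent sets of a matroid. -/
theorem exists_isBicircularMatroid [Finite E(G)] (hγ : ∀ e ∈ E(G), γ e ≠ 0)
    (hgen : G.GenericGains γ) : ∃ M : Matroid β, G.IsBicircularMatroid M := by
  classical
  obtain ⟨σ⟩ := G.nonempty_orientation
  have hfin : (E(G)).Finite := Set.toFinite _
  have key : ∀ I : Set β, I ∈ G.spanningPseudoforests ↔
      I ⊆ E(G) ∧ LinearIndepOn K (G.gainColumn σ γ) (Subtype.val ⁻¹' I) := by
    intro I
    refine and_congr_right fun hI => ?_
    rw [linearIndepOn_gainColumn_iff hγ hgen, Subtype.image_preimage_coe,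
      Set.inter_eq_self_of_subset_right hI]
  let M : IndepMatroid β := IndepMatroid.ofFinite hfin (· ∈ G.spanningPseudoforests)
    (by rw [key]; simp)
    (fun I J hJ hIJ => by
      rw [key] at hJ ⊢
      exact ⟨hIJ.trans hJ.1, hJ.2.mono (Set.preimage_mono hIJ)⟩)
    (fun I J hI hJ hlt => by
      rw [key] at hI hJ
      have hncard : ∀ {L : Set β}, L ⊆ E(G) → (Subtype.val ⁻¹' L : Set E(G)).ncard = L.ncard := by
        intro L hL
        rw [← Set.ncard_image_of_injective _ Subtype.val_injective, Subtype.image_preimage_coe,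
          Set.inter_eq_self_of_subset_right hL]
      obtain ⟨e, heJ, heI, h⟩ := exists_linearIndepOn_insert hI.2 hJ.2
        (by rwa [hncard hI.1, hncard hJ.1])
      refine ⟨e, heJ, heI, (key _).2 ⟨Set.insert_subset e.2 hI.1, ?_⟩⟩
      have hpre : (Subtype.val ⁻¹' insert (e : β) I : Set E(G)) = insert e (Subtype.val ⁻¹' I) := by
        ext f
        simp [Subtype.ext_iff]
      rw [hpre]
      exact h)
    (fun I hI => hI.1)
  exact ⟨M.matroid, by simp [M], fun I => by simp [M]⟩

open Classical in
lemma ncard_spanningPseudoforests [Fintype E(G)] (hγ : ∀ e ∈ E(G), γ e ≠ 0)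
    (hgen : G.GenericGains γ) (σ : G.Orientation) :
    G.spanningPseudoforests.ncard = ((Finset.univ : Finset E(G)).powerset.filter
      fun I : Finset E(G) => LinearIndepOn K (G.gainColumn σ γ) (I : Set E(G))).card := by
  have himage : G.spanningPseudoforests = (fun I : Finset E(G) => Subtype.val '' (I : Set E(G))) ''
      ((Finset.univ : Finset E(G)).powerset.filter
        fun I : Finset E(G) => LinearIndepOn K (G.gainColumn σ γ) (I : Set E(G)) :
          Finset (Finset E(G))) := by
    ext F
    simp only [Finset.coe_filter, Finset.mem_powerset, Finset.subset_univ, true_and,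
      linearIndepOn_gainColumn_iff hγ hgen]
    constructor
    · rintro ⟨hF, hpf⟩
      have hF' : Subtype.val '' (Subtype.val ⁻¹' F : Set E(G)) = F := by
        rw [Subtype.image_preimage_coe, Set.inter_eq_self_of_subset_right hF]
      refine ⟨(Subtype.val ⁻¹' F : Set E(G)).toFinset, ?_, ?_⟩
      · simpa only [Set.mem_ofPred_eq, Set.coe_toFinset, hF'] using hpf
      · simp only [Set.coe_toFinset, hF']
    · rintro ⟨I, hI, rfl⟩
      exact ⟨by rintro _ ⟨e, -, rfl⟩; exact e.2, hI⟩
  rw [himage, Set.ncard_image_of_injective, Set.ncard_coe_finset]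
  exact fun I J h => Finset.coe_injective (Set.image_injective.2 Subtype.val_injective h)

end Graph

theorem mainTheorem2 {K : Type*} [Field K] [CharZero K] {α β : Type*} (G : Graph α β)
    [Finite V(G)] [Fintype E(G)] (γ : β → K) (hγ : ∀ e ∈ E(G), γ e ≠ 0)
    (hgen : G.GenericGains γ) :
    (∀ σ τ : G.Orientation,
      circulationHilbertSeries (G.gainMatrix σ γ) = circulationHilbertSeries (G.gainMatrix τ γ)) ∧
    (∀ σ : G.Orientation,
      Module.finrank K (circulationAlgebra (G.gainMatrix σ γ)) = G.spanningPseudoforests.ncard) ∧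
    ∃ M : Matroid β, G.IsBicircularMatroid M ∧
      ∀ σ : G.Orientation,
        Module.finrank K (circulationAlgebra (G.gainMatrix σ γ)) = {I | M.Indep I}.ncard := by
  classical
  have := Fintype.ofFinite V(G)
  have hdim : ∀ σ : G.Orientation,
      Module.finrank K (circulationAlgebra (G.gainMatrix σ γ)) =
        G.spanningPseudoforests.ncard := by
    intro σ
    rw [finrank_circulationAlgebra, finrank_prodSpan_powerset,
      Graph.ncard_spanningPseudoforests hγ hgen σ]
    rfl
  refine ⟨fun σ τ => ?_, hdim, ?_⟩
  · ext k
    rw [circulationHilbertSeries, circulationHilbertSeries, PowerSeries.coeff_mk,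
      PowerSeries.coeff_mk, finrank_circulationDegreePart, finrank_circulationDegreePart]
    congr 1
    refine finrank_prodSpan_powersetCard_congr _ _ _ (fun I _ => ?_) k
    exact (Graph.linearIndepOn_gainColumn_iff hγ hgen σ I).trans
      (Graph.linearIndepOn_gainColumn_iff hγ hgen τ I).symm
  · obtain ⟨M, hM⟩ := Graph.exists_isBicircularMatroid hγ hgen
    refine ⟨M, hM, fun σ => ?_⟩
    rw [hdim σ]
    congr 1
    ext I
    exact (hM.2 I).symm
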